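/- Let $k$ be a field of characteristic zero. Let $V=\operatorname{Spec} k[S]$ be a (normal) affine toric variety over $k$, where $S$ is a finitely generated saturated submonoid of a lattice $M\cong\mathbb{Z}^m$ that generates $M$ as a group, and let $T=\operatorname{Spec} k[M]\subset V$ be its big torus, with character group $M$. Let $X$ be an algebraic variety over $k$ (an integral separated scheme of finite type over $k$), let $x$ be a closed point of $X$, let $\rho:X\to V$ be an étale $k$-morphism, and put $U_X:=\rho^{-1}(T)$. Let $\psi:X\to V$ be a dominant $k$-morphism mapping $U_X$ into $T$. For $Y=X$ or $Y=V$, with $U_Y$ equal to $U_X$ or $T$ respectively, let $D_Y:=Y\setminus U_Y$ with its reduced structure, let $j:Y_0\to Y$ be the inclusion of the open set of points at which $Y$ is nonsingular and $D_Y$ is nonsingular or empty, and let $\Omega^1_Y(\log D_Y):=j_*\bigl(\Omega^1_{Y_0}(\log (D_Y\cap Y_0))\bigr)$ be the sheaf of logarithmic differential $1$-forms over $k$. The morphism $\psi$ is called logarithmically smooth at $x$ if the sheaf of $\mathcal{O}_X$-modules $\Omega^1_X(\log D_X)/\psi^*(\Omega^1_V(\log D_V))$ is locally free at $x$. Assume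 the following two conditions. (1) For each character $c$ of $T$, the rational function $\rho^*(c)/\psi^*(c)$ on $X$ is a unit in $\mathcal{O}_{X,x}$. (2) The morphism $\psi$ is logarithmically smooth at $x$ (with respect to $U_X\subset X$ and $T\subset V$). Then $\psi$ is étale at $x$. -/

import Mathlib

open CategoryTheory AlgebraicGeometry TopologicalSpace

universe u

namespace LogGeom

/-! ### Rational functions and rational differential forms on `k`-schemes -/

section Pullback

variable {X Y : Scheme.{u}} [IrreducibleSpace X] [IrreducibleSpace Y]

lemma map_genericPoint_specializes (f : X ⟶ Y) [IsDominant f] :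
    f (genericPoint X) ⤳ genericPoint Y := by
  rw [specializes_iff_mem_closure]
  have h1 : closure (f '' closure {genericPoint X}) = closure (f '' {genericPoint X}) :=
    closure_image_closure f.continuous
  rw [genericPoint_closure, Set.image_univ, f.denseRange.closure_range, Set.image_singleton] at h1
  rw [← h1]
  trivial

/-- Pullback of rational functions `f^* : K(Y) → K(X)` along a dominant morphism `f : X ⟶ Y`. -/
noncomputable def pullbackRat (f : X ⟶ Y) [IsDominant f] : Y.functionField →+* X.functionField :=
  (Y.presheaf.stalkSpecializes (map_genericPoint_specializes f) ≫ f.stalkMap (genericPoint X)).hom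

/-- An étale morphism from a nonempty scheme to an irreducible scheme is dominant. -/
instance isDominant_of_etale (f : X ⟶ Y) [Etale f] : IsDominant f := by
  refine ⟨?_⟩
  have ho : IsOpen (Set.range f) := f.isOpenMap.isOpen_range
  exact ho.dense (Set.range_nonempty f)

end Pullback

section Structure

variable (k : Type u) [Field k]

/-- The `k`-algebra structure on the local rings (in particular on the function field) of a
`k`-scheme. -/
noncomputable instance stalkAlgebra (X : Scheme.{u}) [X.Over (Spec (.of k))] (x : X) :
    Algebra k (X.presheaf.stalk x) :=
  RingHom.toAlgebra
    ((Scheme.ΓSpecIso (.of k)).inv ≫ (X ↘ Spec (.of k)).appTop ≫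
      X.presheaf.germ ⊤ x (Opens.mem_top _)).hom

lemma algebraMap_stalk_apply (X : Scheme.{u}) [X.Over (Spec (.of k))] (x : X) (a : k) :
    algebraMap k (X.presheaf.stalk x) a =
      X.presheaf.germ ⊤ x (Opens.mem_top _)
        ((X ↘ Spec (.of k)).appTop ((Scheme.ΓSpecIso (.of k)).inv a)) := rfl

variable {k} in
lemma pullbackRat_algebraMap {X Y : Scheme.{u}} [IrreducibleSpace X] [IrreducibleSpace Y]
    [X.Over (Spec (.of k))] [Y.Over (Spec (.of k))] (f : X ⟶ Y) [f.IsOver (Spec (.of k))]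
    [IsDominant f] (a : k) :
    pullbackRat f (algebraMap k Y.functionField a) = algebraMap k X.functionField a := by
  have h : ((Scheme.ΓSpecIso (.of k)).inv ≫ (Y ↘ Spec (.of k)).appTop ≫
      Y.presheaf.germ ⊤ (genericPoint Y) (Opens.mem_top _)) ≫
      Y.presheaf.stalkSpecializes (map_genericPoint_specializes f) ≫ f.stalkMap (genericPoint X) =
      (Scheme.ΓSpecIso (.of k)).inv ≫ (X ↘ Spec (.of k)).appTop ≫
        X.presheaf.germ ⊤ (genericPoint X) (Opens.mem_top _) := by
    rw [← comp_over f (Spec (.of k))]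
    simp only [Category.assoc, Scheme.Hom.comp_appTop]
    rw [TopCat.Presheaf.germ_stalkSpecializes_assoc, Scheme.Hom.germ_stalkMap]
    rfl
  exact DFunLike.congr_fun (congrArg CommRingCat.Hom.hom h) a

end Structure

/-! ### Logarithmic differential forms -/

section LogForms

variable (k : Type u) [Field k] (X : Scheme.{u}) [IsIntegral X] [X.Over (Spec (.of k))]

/-- The rational differential `1`-forms on `X` over `k`. -/
abbrev RatForms : Type u := Ω[X.functionField⁄k]

variable {X}

/-- `g`, a germ at `p`, is invertible on `U` near `p`, i.e. the divisor of `g` is supported on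
the complement of `U` in some neighbourhood of `p`. -/
def InvertibleOn (U : Set X) {p : X} (g : X.presheaf.stalk p) : Prop :=
  ∃ (W : X.Opens) (hp : p ∈ W) (s : Γ(X, W)), X.presheaf.germ W p hp s = g ∧
    ∀ y ∈ W, y ∈ U → y ∈ X.basicOpen s

/-- The `𝒪_{X,p}`-module generated by the regular differentials `da` at `p`, and by the logarithmic
differentials `dg/g` where `g` runs over the elements of `𝒪_{X,p}` that are invertible on `U`
near `p`.  At a point where both `X` and `D = X \ U` are nonsingular this is the usual stalk of
`Ω¹_X(log D)`: if `t` is a local equation of `D`, then each such `g` is a unit times a power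
of `t`. -/
noncomputable def logFormsAt (U : Set X) (p : X) :
    Submodule (X.presheaf.stalk p) (RatForms k X) :=
  Submodule.span (X.presheaf.stalk p)
    (Set.range (fun a : X.presheaf.stalk p =>
        KaehlerDifferential.D k X.functionField (algebraMap _ X.functionField a)) ∪
      {ω | ∃ g : X.presheaf.stalk p, InvertibleOn U g ∧
        ω = (algebraMap _ X.functionField g)⁻¹ •
          KaehlerDifferential.D k X.functionField (algebraMap _ X.functionField g)})

/-- The ideal in `𝒪_{X,p}` of the reduced closed subscheme `D = X \ U`. -/
noncomputable def boundaryIdeal (U : Set X) (p : X) : Ideal (X.presheaf.stalk p) :=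
  PrimeSpectrum.vanishingIdeal ((X.fromSpecStalk p) ⁻¹' Uᶜ)

/-- The points where `X` is nonsingular and `D = X \ U` (with its reduced structure)
is nonsingular or empty. -/
def niceLocus (U : Set X) : Set X :=
  {p | IsRegularLocalRing (X.presheaf.stalk p) ∧
    (p ∈ U ∨ IsRegularLocalRing (X.presheaf.stalk p ⧸ boundaryIdeal U p))}

lemma stalk_smul_eq {x p : X} {W : X.Opens} (hx : x ∈ W) (hp : p ∈ W) (s : Γ(X, W))
    (ω : RatForms k X) :
    X.presheaf.germ W x hx s • ω = X.presheaf.germ W p hp s • ω := by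
  have : Nonempty W := ⟨⟨x, hx⟩⟩
  rw [← algebraMap_smul X.functionField (X.presheaf.germ W x hx s),
    ← algebraMap_smul X.functionField (X.presheaf.germ W p hp s),
    Scheme.algebraMap_germ_eq_germToFunctionField, Scheme.algebraMap_germ_eq_germToFunctionField]

/-- The stalk at `x` of the sheaf of logarithmic differential forms
`Ω¹_X(log D) = j_* Ω¹_{X₀}(log D ∩ X₀)`, where `D = X \ U` and `j` is the inclusion of the locus
`X₀` where `X` and `D` are nonsingular: the rational forms that, at each point of `X₀` in some
neighbourhood of `x`, belong to the stalk of `Ω¹_{X₀}(log D ∩ X₀)`. -/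
noncomputable def logStalk (U : Set X) (x : X) :
    Submodule (X.presheaf.stalk x) (RatForms k X) where
  carrier := {ω | ∃ W : X.Opens, x ∈ W ∧ ∀ p ∈ W, p ∈ niceLocus U → ω ∈ logFormsAt k U p}
  zero_mem' := ⟨⊤, trivial, fun _ _ _ => Submodule.zero_mem _⟩
  add_mem' := by
    rintro a b ⟨W, hx, hW⟩ ⟨W', hx', hW'⟩
    exact ⟨W ⊓ W', ⟨hx, hx'⟩, fun p hp hn =>
      Submodule.add_mem _ (hW p hp.1 hn) (hW' p hp.2 hn)⟩
  smul_mem' := by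
    rintro f ω ⟨W, hx, hW⟩
    obtain ⟨W', hx', s, rfl⟩ := X.presheaf.exists_germ_eq f
    refine ⟨W ⊓ W', ⟨hx, hx'⟩, fun p hp hn => ?_⟩
    rw [stalk_smul_eq k hx' hp.2]
    exact Submodule.smul_mem _ _ (hW p hp.1 hn)

variable {k}

/-- Pullback of rational differential forms along a dominant `k`-morphism. -/
noncomputable def pullbackForm {Y : Scheme.{u}} [IsIntegral Y] [Y.Over (Spec (.of k))]
    (f : X ⟶ Y) [f.IsOver (Spec (.of k))] [IsDominant f] : RatForms k Y →+ RatForms k X :=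
  letI := (pullbackRat f).toAlgebra
  haveI : IsScalarTower k Y.functionField X.functionField :=
    .of_algebraMap_eq fun a => (pullbackRat_algebraMap f a).symm
  (KaehlerDifferential.map k k Y.functionField X.functionField).toAddMonoidHom

variable (k) in
/-- The image of the stalk at `x` of `f^* Ω¹_Y(log D_Y)` in the rational forms on `X`. -/
noncomputable def pulledBackLogStalk {Y : Scheme.{u}} [IsIntegral Y] [Y.Over (Spec (.of k))]
    (f : X ⟶ Y) [f.IsOver (Spec (.of k))] [IsDominant f] (UY : Set Y) (x : X) :
    Submodule (X.presheaf.stalk x) (RatForms k X) :=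
  Submodule.span (X.presheaf.stalk x) (pullbackForm f '' (logStalk k UY (f x) : Set (RatForms k Y)))

variable (k) in
/-- The dominant `k`-morphism `f : X ⟶ Y`, mapping `UX` into `UY`, is logarithmically smooth
at `x`: the sheaf `Ω¹_X(log D_X) / f^* Ω¹_Y(log D_Y)`, where `D_X = X \ UX` and `D_Y = Y \ UY`,
is locally free at `x`. -/
def LogSmoothAt {Y : Scheme.{u}} [IsIntegral Y] [Y.Over (Spec (.of k))]
    (f : X ⟶ Y) [f.IsOver (Spec (.of k))] [IsDominant f] (UX : Set X) (UY : Set Y) (x : X) : Prop :=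
  Module.Free (X.presheaf.stalk x)
    (logStalk k UX x ⧸ (pulledBackLogStalk k f UY x).submoduleOf (logStalk k UX x))

end LogForms

/-! ### Affine toric varieties -/

section Toric

variable (k : Type u) [Field k] {M : Type u} [AddCommGroup M]

/-- A finitely generated saturated submonoid `S` of a lattice `M` that generates `M` as a group;
equivalently `S = σ^∨ ∩ M` for a strongly convex rational polyhedral cone `σ`. -/
structure IsToricMonoid (S : AddSubmonoid M) : Prop where
  fg : S.FG
  saturated : S.NSMulSaturated
  generates : AddSubgroup.closure (S : Set M) = ⊤

/-- The affine toric variety `V = Spec k[S]`. -/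
noncomputable abbrev toricVariety (S : AddSubmonoid M) : Scheme.{u} :=
  Spec (.of (AddMonoidAlgebra k S))

/-- `V` as a `k`-scheme. -/
noncomputable instance toricOver (S : AddSubmonoid M) :
    (toricVariety k S).Over (Spec (.of k)) where
  hom := Spec.map (CommRingCat.ofHom (algebraMap k (AddMonoidAlgebra k S)))

/-- The big torus `T` of `V`: the image of `Spec k[M] ⟶ Spec k[S]`. -/
def bigTorus (S : AddSubmonoid M) : Set (toricVariety k S) :=
  Set.range (Spec.map (CommRingCat.ofHom (AddMonoidAlgebra.mapDomainRingHom k S.subtype)))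

variable [Module.Free ℤ M]

instance isDomain_monoidAlgebra (S : AddSubmonoid M) : IsDomain (AddMonoidAlgebra k S) := by
  let b := Module.Free.chooseBasis ℤ M
  let g : S →ₙ+ (Module.Free.ChooseBasisIndex ℤ M →₀ ℤ) :=
    ⟨fun m => b.repr m.1, fun m n => map_add b.repr m.1 n.1⟩
  have : UniqueSums S := UniqueSums.of_injective_addHom g
    (b.repr.injective.comp Subtype.val_injective) inferInstance
  infer_instance

variable {k} in
/-- The regular function on `V` given by the character in `S`, as a rational function. -/
noncomputable def monomialRat {S : AddSubmonoid M} (a : S) : (toricVariety k S).functionField :=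
  (toricVariety k S).presheaf.germ ⊤ (genericPoint (toricVariety k S)) (Opens.mem_top _)
    ((Scheme.ΓSpecIso (.of (AddMonoidAlgebra k S))).inv
      (AddMonoidAlgebra.single a 1 : AddMonoidAlgebra k S))

variable {k} in
/-- The characters of the big torus, as rational functions on `V`. Each element of `M` is a
difference of elements of `S`, so these are the quotients of monomials. -/
def IsCharacter {S : AddSubmonoid M} (c : (toricVariety k S).functionField) : Prop :=
  ∃ a b : S, c = monomialRat a / monomialRat b

end Toric

end LogGeom

open LogGeom

/-!
The morphism `ρ` is étale, and near `x` the monomials pulled back along `ρ` and along `ψ` differ by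
units: `ρ(s) = u(s) ψ(s)` for a character `u : M → Bˣ`, where `B = 𝒪_{X,x}`. So `ψ` is a "twist" of
the étale morphism `ρ` by a morphism to a torus, and whether it is étale can be read off from the
logarithmic derivative of `u`.

Let `δ₁, …, δₘ` be the derivations of `B` that extend, along `ρ`, the logarithmic derivations
`s ↦ sᵢ s` of `k[S]`. If the matrix of the `δᵢ(ψ(eⱼ)) / ψ(eⱼ)` is invertible over `B`, then `ψ` is
formally étale at `x` (`formallyEtale_of_unit_twist`): to lift a map out of `B` along a square-zero
ideal `I`, so that it takes prescribed values on the image of `ψ`, choose a lift of `u`. That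
determines the values on the image of `ρ`, hence a lift of the map; changing this lift along
`∑ tᵢ δᵢ`, `tᵢ ∈ I`, changes its defect by that matrix, so there is exactly one lift with no defect.

The matrix is invertible as soon as each `dlog ρ(eⱼ)` is a `B`-linear combination of the
`dlog ψ(eᵢ)`: apply the `δₗ` (`formallyEtale_of_free_quotient`). This is where the logarithmic
smoothness enters. In characteristic zero, the function field of `X` is étale over `k[S]` also along
`ψ`, as it has the same transcendence degree, so the `dlog ψ(eᵢ)` span the rational forms, and the
quotient of the logarithmic forms on `X` by the pullback of those on `V` is torsion. Being free, it
vanishes, and `dlog ρ(eⱼ)`, which is a logarithmic form on `X`, is in the pullback.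

It remains to know that the logarithmic forms on `V` are generated by the logarithmic differentials
of monomials (`logStalk_bigTorus_le`). As `k[S]` is normal (`IsToricMonoid.isIntegrallyClosed`),
it suffices to see that the coordinates of a logarithmic form with respect to the `dlog eᵢ` are
regular at each prime whose local ring is a discrete valuation ring or a field
(`exists_isPrincipalIdealRing_of_not_regular`). Such a prime lies in the locus where `V` and the
boundary are nonsingular, and outside of the torus its local ring has a monomial uniformizer
(`exists_unit_mul_monomial`), so the regularity of the coordinates is visible there.
-/

namespace LogGeom

/-! ### Infinitesimal lifting and twisting by units -/

section Lifting

variable {A B C : Type*} [CommRing A] [CommRing B] [CommRing C]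

lemma exists_lift_of_formallyEtale {f : A →+* B}
    (hf : letI := f.toAlgebra; Algebra.FormallyEtale A B) (φ : A →+* C) {I : Ideal C}
    (hI : I ^ 2 = ⊥) (g : B →+* C ⧸ I) (h : g.comp f = (Ideal.Quotient.mk I).comp φ) :
    ∃ g₀ : B →+* C, g₀.comp f = φ ∧ (Ideal.Quotient.mk I).comp g₀ = g := by
  let := f.toAlgebra
  let := φ.toAlgebra
  have := hf
  obtain ⟨g₀, hg₀⟩ := (Algebra.FormallyEtale.comp_bijective A B I hI).2
    { g with commutes' := fun a => DFunLike.congr_fun h a }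
  exact ⟨g₀, g₀.comp_algebraMap, congrArg AlgHom.toRingHom hg₀⟩

lemma lift_unique_of_formallyEtale {f : A →+* B}
    (hf : letI := f.toAlgebra; Algebra.FormallyEtale A B) {I : Ideal C}
    (hI : I ^ 2 = ⊥) {g g' : B →+* C} (h : g.comp f = g'.comp f)
    (hgg' : (Ideal.Quotient.mk I).comp g = (Ideal.Quotient.mk I).comp g') : g = g' := by
  let := f.toAlgebra
  let := (g.comp f).toAlgebra
  have := hf
  have := @(Algebra.FormallyEtale.comp_bijective A B I hI).1
    { g with commutes' := fun a => rfl }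
    { g' with commutes' := fun a => (DFunLike.congr_fun h a).symm }
    (AlgHom.ext fun b => DFunLike.congr_fun hgg' b)
  exact congrArg AlgHom.toRingHom this

lemma formallyEtale_of_existsUnique_lift {A B : Type u} [CommRing A] [CommRing B] {f : A →+* B}
    (hex : ∀ (C : Type u) [CommRing C] (φ : A →+* C) (I : Ideal C), I ^ 2 = ⊥ →
      ∀ g : B →+* C ⧸ I, g.comp f = (Ideal.Quotient.mk I).comp φ →
      ∃ g₀ : B →+* C, g₀.comp f = φ ∧ (Ideal.Quotient.mk I).comp g₀ = g)
    (huniq : ∀ (C : Type u) [CommRing C] (I : Ideal C), I ^ 2 = ⊥ →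
      ∀ g g' : B →+* C, g.comp f = g'.comp f →
      (Ideal.Quotient.mk I).comp g = (Ideal.Quotient.mk I).comp g' → g = g') :
    let := f.toAlgebra; Algebra.FormallyEtale A B := by
  let := f.toAlgebra
  refine Algebra.FormallyEtale.iff_comp_bijective.mpr fun C _ _ I hI =>
    ⟨fun g g' h => ?_, fun g => ?_⟩
  · have := huniq C I hI g g' (g.comp_algebraMap.trans g'.comp_algebraMap.symm)
      (congrArg AlgHom.toRingHom h)
    exact AlgHom.ext fun b => DFunLike.congr_fun this b
  · obtain ⟨g₀, h₀, h₁⟩ := hex C (algebraMap A C) I hI g g.comp_algebraMap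
    exact ⟨{ g₀ with commutes' := fun a => DFunLike.congr_fun h₀ a },
      AlgHom.ext fun b => DFunLike.congr_fun h₁ b⟩

end Lifting

section LatticeCharacters

variable {M ι : Type*} [AddCommGroup M]

lemma monoidHom_ext_basis {G : Type*} [CommGroup G] (b : Module.Basis ι ℤ M)
    {p q : Multiplicative M →* G}
    (h : ∀ j, p (.ofAdd (b j)) = q (.ofAdd (b j))) : p = q := by
  have : (MonoidHom.toAdditiveRight p).toIntLinearMap =
      (MonoidHom.toAdditiveRight q).toIntLinearMap :=
    b.ext fun j => congrArg Additive.ofMul (h j)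
  ext m
  exact congrArg Additive.toMul (DFunLike.congr_fun this m)

lemma exists_monoidHom_basis {G : Type*} [CommGroup G] (b : Module.Basis ι ℤ M) (c : ι → G) :
    ∃ p : Multiplicative M →* G, ∀ j, p (.ofAdd (b j)) = c j := by
  refine ⟨MonoidHom.toAdditiveRight.symm
    (b.constr ℤ (fun j => Additive.ofMul (c j))).toAddMonoidHom, fun j => ?_⟩
  exact congrArg Additive.toMul (b.constr_basis ℤ (fun j => Additive.ofMul (c j)) j)

end LatticeCharacters

section FirstOrder

variable {k B C ι M : Type*} [CommRing k] [CommRing B] [CommRing C] [Algebra k B] [Fintype ι]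

/-- Moving a ring homomorphism along derivations, with increments of square zero. -/
lemma exists_ringHom_add_derivation (g : B →+* C) (δ : ι → Derivation k B B) (t : ι → C)
    (ht : ∀ i j, t i * t j = 0) :
    ∃ g' : B →+* C, ∀ b, g' b = g b + ∑ i, t i * g (δ i b) := by
  refine ⟨{ toFun := fun b => g b + ∑ i, t i * g (δ i b), map_one' := by simp, map_zero' := by simp,
            map_add' := fun x y => ?_, map_mul' := fun x y => ?_ }, fun _ => rfl⟩
  · have h0 : (∑ i, t i * g (δ i x)) * (∑ i, t i * g (δ i y)) = 0 := by
      rw [Finset.sum_mul_sum]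
      refine Finset.sum_eq_zero fun i _ => Finset.sum_eq_zero fun j _ => ?_
      rw [mul_mul_mul_comm, ht, zero_mul]
    have h1 : ∑ i, t i * g (δ i (x * y)) =
        g x * (∑ i, t i * g (δ i y)) + g y * (∑ i, t i * g (δ i x)) := by
      rw [Finset.mul_sum, Finset.mul_sum, ← Finset.sum_add_distrib]
      refine Finset.sum_congr rfl fun i _ => ?_
      simp only [Derivation.leibniz, smul_eq_mul, map_add, map_mul]
      ring
    rw [h1, map_mul]
    linear_combination -h0
  · simp only [map_add, mul_add, Finset.sum_add_distrib]
    ring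

variable [AddCommGroup M]

/-- Two characters of a lattice with values in `Cˣ` which on a basis differ by factors `1 + tⱼ`,
with increments `tⱼ` of square zero, differ at `m` by the factor `1 + ∑ mᵢ tᵢ`. -/
lemma monoidHom_eq_mul_one_add (b : Module.Basis ι ℤ M) (p q : Multiplicative M →* Cˣ) (t : ι → C)
    (ht : ∀ i j, t i * t j = 0)
    (h : ∀ j, (q (.ofAdd (b j)) : C) = p (.ofAdd (b j)) * (1 + t j)) (m : M) :
    (q (.ofAdd m) : C) = p (.ofAdd m) * (1 + ∑ i, (b.repr m i : C) * t i) := by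
  classical
  let τ : M → C := fun m => ∑ i, (b.repr m i : C) * t i
  have hτ : ∀ m n, τ m * τ n = 0 := fun m n => by
    simp only [τ, Finset.sum_mul_sum]
    refine Finset.sum_eq_zero fun i _ => Finset.sum_eq_zero fun j _ => ?_
    rw [mul_mul_mul_comm, ht, mul_zero]
  have hadd : ∀ m n, τ (m + n) = τ m + τ n := fun m n => by
    simp [τ, add_mul, Finset.sum_add_distrib]
  have hneg : ∀ m, τ (-m) = -τ m := fun m => by simp [τ]
  let r : Multiplicative M →* Cˣ :=
    { toFun := fun m => ⟨1 + τ m.toAdd, 1 + τ (-m.toAdd),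
        by rw [hneg]; linear_combination -hτ m.toAdd m.toAdd,
        by rw [hneg]; linear_combination -hτ m.toAdd m.toAdd⟩
      map_one' := by ext; simp [τ]
      map_mul' := fun m n => by
        ext
        simp only [toAdd_mul, Units.val_mul, hadd]
        linear_combination -hτ m.toAdd n.toAdd }
  have : q = p * r := monoidHom_ext_basis b fun j => by
    ext
    simp [h, r, τ, Finsupp.single_apply]
  rw [this]
  rfl

end FirstOrder

section Twist

lemma monoidAlgebra_ringHom_ext {k M A : Type*} [CommSemiring k] [AddMonoid M] [Semiring A]
    {f g : AddMonoidAlgebra k M →+* A}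
    (h₀ : ∀ a, f (algebraMap k _ a) = g (algebraMap k _ a))
    (h₁ : ∀ m, f (.single m 1) = g (.single m 1)) : f = g := by
  refine AddMonoidAlgebra.ringHom_ext (fun r => ?_) h₁
  simpa using h₀ r

lemma isUnit_of_isUnit_mk {C : Type*} [CommRing C] {I : Ideal C} (hI : I ^ 2 = ⊥) {c : C}
    (hc : IsUnit (Ideal.Quotient.mk I c)) : IsUnit c := by
  obtain ⟨d, hd⟩ := hc.exists_right_inv
  obtain ⟨d, rfl⟩ := Ideal.Quotient.mk_surjective d
  rw [← map_mul, ← map_one (Ideal.Quotient.mk I), Ideal.Quotient.eq] at hd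
  have h0 : (c * d - 1) * (c * d - 1) = 0 := by
    have := Ideal.mul_mem_mul hd hd
    rwa [← pow_two I, hI] at this
  exact IsUnit.of_mul_eq_one (d * (2 - c * d)) (by linear_combination -h0)

variable {k M ι B : Type u} [CommRing k] [AddCommGroup M] {S : AddSubmonoid M} [Fintype ι]
  [DecidableEq ι] [CommRing B] [Algebra k B]

/-- Let `ρ : k[S] → B` be formally étale, and let `ψ : k[S] → B` differ from `ρ` on monomials by
units `u m`. If the matrix `(δᵢ log ψ(eⱼ))ᵢⱼ` is invertible, where `δᵢ` extends the `i`-th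
logarithmic derivation of `k[S]` along `ρ`, then `ψ` is formally étale: a lift of a map out of `B`
is the same thing as a lift of the `ρ(s)`, and changing that lift by a homomorphism
`M → 1 + I` changes the values at the `ψ(s)` by the (invertible) matrix. -/
theorem formallyEtale_of_unit_twist (b : Module.Basis ι ℤ M)
    (ρ ψ : AddMonoidAlgebra k S →ₐ[k] B)
    (hρ : letI := ρ.toRingHom.toAlgebra; Algebra.FormallyEtale (AddMonoidAlgebra k S) B)
    (u : Multiplicative M →* Bˣ)
    (hu : ∀ s : S, ρ (.single s 1) = u (.ofAdd s.1) * ψ (.single s 1))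
    (δ : ι → Derivation k B B)
    (hδ : ∀ i (s : S), δ i (ρ (.single s 1)) = (b.repr s.1 i : B) * ρ (.single s 1))
    (Q : Matrix ι ι B)
    (hQ : (Matrix.of fun i j => (if i = j then 1 else 0) -
      ((u (.ofAdd (b j)))⁻¹ : Bˣ) * δ i (u (.ofAdd (b j)) : B)) * Q = 1) :
    let := ψ.toRingHom.toAlgebra; Algebra.FormallyEtale (AddMonoidAlgebra k S) B := by
  set L : Matrix ι ι B := Matrix.of fun i j => (if i = j then 1 else 0) -
      ((u (.ofAdd (b j)))⁻¹ : Bˣ) * δ i (u (.ofAdd (b j)) : B) with hL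
  have hQ' : Q * L = 1 := mul_eq_one_comm.mp hQ
  have hprod {C : Type u} [CommRing C] {I : Ideal C} (hI : I ^ 2 = ⊥) {x y : C} (hx : x ∈ I)
      (hy : y ∈ I) : x * y = 0 := by
    have := Ideal.mul_mem_mul hx hy
    rwa [← pow_two I, hI] at this
  -- the increment of a first-order change of `g` at `uⱼ`, in terms of the matrix `L`
  have hLg {C : Type u} [CommRing C] (g : B →+* C) (t : ι → C) (j : ι) :
      ∑ i, t i * g (δ i (u (.ofAdd (b j)) : B)) =
        g (u (.ofAdd (b j))) * (t j - ∑ i, t i * g (L i j)) := by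
    have h1 : ∀ i, g (δ i (u (.ofAdd (b j)) : B)) =
        g (u (.ofAdd (b j))) * ((if i = j then 1 else 0) - g (L i j)) := fun i => by
      have : δ i (u (.ofAdd (b j)) : B) =
          (u (.ofAdd (b j))) * ((if i = j then 1 else 0) - L i j) := by
        simp [hL]
      rw [this]
      simp [apply_ite g]
    simp only [h1, mul_sub, Finset.sum_sub_distrib, Finset.mul_sum]
    congr 1
    · simp [mul_comm]
    · exact Finset.sum_congr rfl fun i _ => by ring
  refine formallyEtale_of_existsUnique_lift ?_ ?_
  · intro C _ φ I hI g hg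
    let : Algebra k C := (φ.comp (algebraMap k (AddMonoidAlgebra k S))).toAlgebra
    have hgψ : ∀ a, g (ψ a) = Ideal.Quotient.mk I (φ a) := fun a => DFunLike.congr_fun hg a
    have hc : ∀ j, ∃ c : Cˣ, Ideal.Quotient.mk I c = g (u (.ofAdd (b j))) := fun j => by
      obtain ⟨c, hc⟩ := Ideal.Quotient.mk_surjective (g (u (.ofAdd (b j))))
      have : IsUnit c := isUnit_of_isUnit_mk hI (hc ▸ (u (.ofAdd (b j))).isUnit.map g)
      exact ⟨this.unit, hc⟩
    choose c hc using hc
    obtain ⟨v, hv⟩ := exists_monoidHom_basis b c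
    have hvg : ∀ m, Ideal.Quotient.mk I (v m) = g (u m) := fun m => by
      have : (Units.map (Ideal.Quotient.mk I).toMonoidHom).comp v =
          (Units.map g.toMonoidHom).comp u := monoidHom_ext_basis b fun j => by
        ext
        simp [hv, hc]
      exact congrArg Units.val (DFunLike.congr_fun this m)
    -- the lift of the `ρ(s)` determined by `v`
    let F : Multiplicative S →* C :=
      { toFun := fun s => v (.ofAdd (s.toAdd : M)) * φ (.single s.toAdd 1)
        map_one' := by
          simp [← AddMonoidAlgebra.one_def]
        map_mul' := fun s s' => by
          have : (AddMonoidAlgebra.single (s.toAdd + s'.toAdd) 1 : AddMonoidAlgebra k S) =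
            .single s.toAdd 1 * .single s'.toAdd 1 := by simp [AddMonoidAlgebra.single_mul_single]
          rw [toAdd_mul, this]
          simp only [AddSubmonoid.coe_add, ofAdd_add, map_mul, Units.val_mul]
          ring }
    let σ := AddMonoidAlgebra.lift k C S F
    have hσ : ∀ s : S, σ (.single s 1) = v (.ofAdd s.1) * φ (.single s 1) := fun s => by
      simp [σ, F]
    obtain ⟨g₀, hg₀, hg₀'⟩ := exists_lift_of_formallyEtale hρ σ.toRingHom hI g (by
      refine monoidAlgebra_ringHom_ext (fun a => ?_) fun s => ?_
      · change g (ρ _) = Ideal.Quotient.mk I (σ _)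
        rw [AlgHom.commutes, AlgHom.commutes, ← ψ.commutes, hgψ]
        rfl
      · change g (ρ _) = Ideal.Quotient.mk I (σ _)
        rw [hu, hσ, map_mul, map_mul, hgψ, hvg])
    have hg₀ρ : ∀ a, g₀ (ρ a) = σ a := fun a => DFunLike.congr_fun hg₀ a
    have hg₀I : ∀ x, Ideal.Quotient.mk I (g₀ x) = g x := fun a => DFunLike.congr_fun hg₀' a
    -- the correction making the lift compatible with `ψ`
    let w : ι → C := fun j => 1 - g₀ ((u (.ofAdd (b j)))⁻¹ : Bˣ) * v (.ofAdd (b j))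
    have hw : ∀ j, w j ∈ I := fun j => by
      rw [← Ideal.Quotient.eq_zero_iff_mem]
      simp only [w, map_sub, map_one, map_mul, hg₀I, hvg]
      rw [← map_mul, Units.inv_mul, map_one, sub_self]
    have hw' : ∀ j, (v (.ofAdd (b j)) : C) = g₀ (u (.ofAdd (b j))) * (1 - w j) := fun j => by
      simp only [w, sub_sub_cancel]
      rw [← mul_assoc, ← map_mul, Units.mul_inv, map_one, one_mul]
    let t : ι → C := fun i => ∑ j, w j * g₀ (Q j i)
    have htI : ∀ i, t i ∈ I := fun i => I.sum_mem fun j _ => I.mul_mem_right _ (hw j)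
    have ht : ∀ i j, t i * t j = 0 := fun i j => hprod hI (htI i) (htI j)
    have htL : ∀ j, ∑ i, t i * g₀ (L i j) = w j := fun j => by
      simp only [t, Finset.sum_mul]
      rw [Finset.sum_comm]
      have : ∀ l, ∑ i, w l * g₀ (Q l i) * g₀ (L i j) = w l * g₀ ((1 : Matrix ι ι B) l j) :=
          fun l => by
        rw [← hQ', Matrix.mul_apply, map_sum, Finset.mul_sum]
        exact Finset.sum_congr rfl fun i _ => by rw [map_mul, mul_assoc]
      simp [this, Matrix.one_apply, apply_ite g₀]
    obtain ⟨g₁, hg₁⟩ := exists_ringHom_add_derivation g₀ δ t ht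
    have hg₁u : ∀ m, g₁ (u (.ofAdd m)) = v (.ofAdd m) * (1 + ∑ i, (b.repr m i : C) * t i) :=
      monoidHom_eq_mul_one_add b v ((Units.map g₁.toMonoidHom).comp u) t ht fun j => by
        change g₁ (u _) = _
        rw [hg₁, hLg, htL, hw']
        linear_combination g₀ (u (.ofAdd (b j))) * hprod hI (hw j) (htI j)
    have hg₁ρ : ∀ s : S, g₁ (ρ (.single s 1)) =
        v (.ofAdd s.1) * φ (.single s 1) * (1 + ∑ i, (b.repr s.1 i : C) * t i) := fun s => by
      rw [hg₁, ← hσ, ← hg₀ρ, mul_add, mul_one, Finset.mul_sum]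
      congr 1
      refine Finset.sum_congr rfl fun i _ => ?_
      rw [hδ]
      simp only [map_mul, map_intCast]
      ring
    refine ⟨g₁, ?_, ?_⟩
    · refine monoidAlgebra_ringHom_ext (fun a => ?_) fun s => ?_
      · change g₁ (ψ _) = φ _
        have h := hg₀ρ (algebraMap k _ a)
        rw [AlgHom.commutes, AlgHom.commutes] at h
        rw [AlgHom.commutes, hg₁]
        refine Eq.trans ?_ h
        simp
      · change g₁ (ψ _) = φ _
        refine (((u (.ofAdd s.1)).isUnit.map g₁).mul_right_inj).mp ?_
        rw [← map_mul, ← hu, hg₁ρ, hg₁u]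
        ring
    · ext x
      change Ideal.Quotient.mk I (g₁ x) = g x
      rw [hg₁, map_add, hg₀I, Ideal.Quotient.eq_zero_iff_mem.mpr, add_zero]
      exact I.sum_mem fun i _ => I.mul_mem_right _ (htI i)
  · -- two lifts differ at the `uⱼ` by factors `1 + tⱼ`, so `g'` is `g` moved along `∑ tᵢ δᵢ`;
    -- as both agree on the image of `ψ`, the matrix `L` kills `t`
    intro C _ I hI g g' hψ hI'
    have hψ' : ∀ a, g (ψ a) = g' (ψ a) := fun a => DFunLike.congr_fun hψ a
    have hdI : ∀ x, g' x - g x ∈ I := fun x => by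
      rw [← Ideal.Quotient.eq]
      exact (DFunLike.congr_fun hI' x).symm
    let t : ι → C := fun j =>
      g ((u (.ofAdd (b j)))⁻¹ : Bˣ) * (g' (u (.ofAdd (b j))) - g (u (.ofAdd (b j))))
    have htI : ∀ i, t i ∈ I := fun i => I.mul_mem_left _ (hdI _)
    have ht : ∀ i j, t i * t j = 0 := fun i j => hprod hI (htI i) (htI j)
    have ht' : ∀ j, g' (u (.ofAdd (b j))) = g (u (.ofAdd (b j))) * (1 + t j) := fun j => by
      have : g (u (.ofAdd (b j))) * g ((u (.ofAdd (b j)))⁻¹ : Bˣ) = 1 := by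
        rw [← map_mul, Units.mul_inv, map_one]
      simp only [t]
      linear_combination -(g' (u (.ofAdd (b j))) - g (u (.ofAdd (b j)))) * this
    obtain ⟨g₁, hg₁⟩ := exists_ringHom_add_derivation g δ t ht
    have hg'u : ∀ m, g' (u (.ofAdd m)) = g (u (.ofAdd m)) * (1 + ∑ i, (b.repr m i : C) * t i) :=
      monoidHom_eq_mul_one_add b ((Units.map g.toMonoidHom).comp u)
        ((Units.map g'.toMonoidHom).comp u) t ht ht'
    have hg'1 : g' = g₁ := by
      refine lift_unique_of_formallyEtale hρ hI ?_ ?_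
      · refine monoidAlgebra_ringHom_ext (fun a => ?_) fun s => ?_
        · change g' (ρ _) = g₁ (ρ _)
          have h := hψ' (algebraMap k _ a)
          rw [AlgHom.commutes] at h
          rw [AlgHom.commutes, hg₁]
          simpa using h.symm
        · change g' (ρ _) = g₁ (ρ _)
          rw [hg₁]
          have h3 : ∑ i, t i * g (δ i (ρ (.single s 1))) =
              (∑ i, (b.repr s.1 i : C) * t i) * g (ρ (.single s 1)) := by
            rw [Finset.sum_mul]
            refine Finset.sum_congr rfl fun i _ => ?_
            rw [hδ]
            simp only [map_mul, map_intCast]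
            ring
          rw [h3, hu, map_mul, map_mul, hg'u, ← hψ']
          ring
      · ext x
        refine Ideal.Quotient.eq.mpr ?_
        rw [hg₁]
        have h5 := hdI x
        have h4 : ∑ i, t i * g (δ i x) ∈ I := I.sum_mem fun i _ => I.mul_mem_right _ (htI i)
        have := I.sub_mem h5 h4
        rwa [sub_sub] at this
    have htL : ∀ j, ∑ i, t i * g (L i j) = 0 := fun j => by
      have h1 := ht' j
      rw [hg'1, hg₁, hLg] at h1
      refine (((u (.ofAdd (b j))).isUnit.map g).mul_right_inj).mp ?_
      linear_combination -h1
    have ht0 : ∀ i, t i = 0 := fun i => by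
      have h1 : ∑ j, (∑ l, t l * g (L l j)) * g (Q j i) = 0 := by simp [htL]
      simp only [Finset.sum_mul] at h1
      rw [Finset.sum_comm] at h1
      have : ∀ l, ∑ j, t l * g (L l j) * g (Q j i) = t l * g ((1 : Matrix ι ι B) l i) :=
          fun l => by
        rw [← hQ, Matrix.mul_apply, map_sum, Finset.mul_sum]
        exact Finset.sum_congr rfl fun i _ => by rw [map_mul, mul_assoc]
      simpa [this, Matrix.one_apply, apply_ite g] using h1
    ext x
    rw [hg'1, hg₁]
    simp [ht0]

end Twist

/-! ### Normality of the coordinate ring of an affine toric variety -/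

section MonomialLocalization

variable {k P M : Type*} [Field k] [AddCommMonoid P] [AddCommGroup M]

/-- If `φ : P → M` identifies the group `M` with the group of differences of the monoid `P`, then
`k[M]` is the localization of `k[P]` at the monomials. -/
lemma isLocalization_monomials (φ : P →+ M) (hφ : Function.Injective φ)
    (h : ∀ m, ∃ p q, φ p = m + φ q) :
    letI := (AddMonoidAlgebra.mapDomainRingHom k φ).toAlgebra
    IsLocalization (MonoidHom.mrange (AddMonoidAlgebra.of k P)) (AddMonoidAlgebra k M) := by
  let : Algebra (AddMonoidAlgebra k P) (AddMonoidAlgebra k M) :=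
    (AddMonoidAlgebra.mapDomainRingHom k φ).toAlgebra
  have halg : ∀ f, algebraMap (AddMonoidAlgebra k P) (AddMonoidAlgebra k M) f =
    AddMonoidAlgebra.mapDomain φ f := fun f => rfl
  have hinj : Function.Injective (algebraMap (AddMonoidAlgebra k P) (AddMonoidAlgebra k M)) :=
    AddMonoidAlgebra.mapDomain_injective hφ
  refine ⟨?_, ?_, ?_⟩
  · rintro ⟨_, p, rfl⟩
    refine IsUnit.of_mul_eq_one (AddMonoidAlgebra.single (-φ p.toAdd) 1) ?_
    simp [halg, AddMonoidAlgebra.of, AddMonoidAlgebra.one_def]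
  · intro z
    induction z using AddMonoidAlgebra.induction_linear with
    | zero => exact ⟨(0, 1), by simp⟩
    | add f g hf hg =>
      obtain ⟨⟨a, s⟩, hf⟩ := hf
      obtain ⟨⟨c, t⟩, hg⟩ := hg
      refine ⟨(a * t + c * s, s * t), ?_⟩
      simp only [Submonoid.coe_mul, map_mul, map_add] at hf hg ⊢
      rw [← hf, ← hg]
      ring
    | single m r =>
      obtain ⟨p, q, hpq⟩ := h m
      refine ⟨(.single p r, ⟨AddMonoidAlgebra.of k P (.ofAdd q), _, rfl⟩), ?_⟩
      simp [halg, AddMonoidAlgebra.of, hpq]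
  · intro x y hxy
    exact ⟨1, by rw [hinj hxy]⟩

end MonomialLocalization

section Normal

variable (k : Type u) [Field k] {M : Type u} [AddCommGroup M]

/-- The group algebra of a lattice is a localization of a polynomial ring, hence normal. -/
lemma isIntegrallyClosed_groupAlgebra (M : Type u) [AddCommGroup M] [Module.Free ℤ M] :
    IsIntegrallyClosed (AddMonoidAlgebra k M) := by
  let b := Module.Free.chooseBasis ℤ M
  let ι := Module.Free.ChooseBasisIndex ℤ M
  let φ : (ι →₀ ℕ) →+ M := b.repr.symm.toAddEquiv.toAddMonoidHom.comp
    (Finsupp.mapRange.addMonoidHom (Nat.castAddMonoidHom ℤ))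
  have hφ : Function.Injective φ := b.repr.symm.injective.comp
    (Finsupp.mapRange_injective _ (by simp) Nat.cast_injective)
  have h := isLocalization_monomials (k := k) φ hφ fun m => by
    refine ⟨(b.repr m).mapRange Int.toNat rfl, (-b.repr m).mapRange Int.toNat rfl, ?_⟩
    apply b.repr.injective
    ext i
    simp only [φ, map_add, AddMonoidHom.comp_apply]
    simp
    omega
  let := (AddMonoidAlgebra.mapDomainRingHom k φ).toAlgebra
  have : IsIntegrallyClosed (AddMonoidAlgebra k (ι →₀ ℕ)) :=
    inferInstanceAs (IsIntegrallyClosed (MvPolynomial ι k))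
  have : IsDomain (AddMonoidAlgebra k (ι →₀ ℕ)) :=
    inferInstanceAs (IsDomain (MvPolynomial ι k))
  refine isIntegrallyClosed_of_isLocalization (AddMonoidAlgebra k M)
    (MonoidHom.mrange (AddMonoidAlgebra.of k (ι →₀ ℕ))) ?_
  rintro _ ⟨p, rfl⟩
  refine mem_nonZeroDivisors_of_ne_zero fun h => ?_
  exact AddMonoidAlgebra.single_ne_zero.mpr one_ne_zero h

variable {k}

/-- `a` is the exponent of the leading term of `f`, for the ordering induced by `D`. -/
def IsLeadingExponent {Γ : Type*} [LinearOrder Γ] (D : M → Γ) (f : AddMonoidAlgebra k M) (a : M) :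
    Prop :=
  a ∈ f.coeff.support ∧ ∀ b ∈ f.coeff.support, D b ≤ D a

lemma exists_isLeadingExponent {Γ : Type*} [LinearOrder Γ] (D : M → Γ)
    {f : AddMonoidAlgebra k M} (hf : f ≠ 0) :
    ∃ a, IsLeadingExponent D f a := by
  have : f.coeff.support.Nonempty := by
    rw [Finsupp.support_nonempty_iff]
    exact fun h => hf (by ext; simp [h])
  obtain ⟨a, ha, h⟩ := Finset.exists_max_image _ D this
  exact ⟨a, ha, h⟩

section Leading

variable {Γ : Type*} [AddCommGroup Γ] [LinearOrder Γ] [IsOrderedAddMonoid Γ] {D : M →+ Γ}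

lemma IsLeadingExponent.mul (hD : Function.Injective D) {f g : AddMonoidAlgebra k M} {a b : M}
    (hf : IsLeadingExponent D f a) (hg : IsLeadingExponent D g b) :
    IsLeadingExponent D (f * g) (a + b) := by
  classical
  refine ⟨?_, fun c hc => ?_⟩
  · have : UniqueAdd f.coeff.support g.coeff.support a b := fun x y hx hy hxy => by
      have h1 := hf.2 x hx
      have h2 := hg.2 y hy
      have h3 : D x + D y = D a + D b := by rw [← map_add, hxy, map_add]
      have h4 := (add_eq_add_iff_eq_and_eq h1 h2).mp h3
      exact ⟨hD h4.1, hD h4.2⟩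
    rw [Finsupp.mem_support_iff, AddMonoidAlgebra.coeff_mul_add_of_uniqueAdd this]
    exact mul_ne_zero (Finsupp.mem_support_iff.mp hf.1) (Finsupp.mem_support_iff.mp hg.1)
  · obtain ⟨x, hx, y, hy, rfl⟩ :=
      Finset.mem_add.mp (AddMonoidAlgebra.support_coeff_mul_subset _ _ hc)
    rw [map_add, map_add]
    exact add_le_add (hf.2 x hx) (hg.2 y hy)

lemma IsLeadingExponent.pow (hD : Function.Injective D) {f : AddMonoidAlgebra k M} {a : M}
    (hf : IsLeadingExponent D f a) (n : ℕ) : IsLeadingExponent D (f ^ n) (n • a) := by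
  induction n with
  | zero => simp [IsLeadingExponent, AddMonoidAlgebra.one_def]
  | succ n ih => rw [pow_succ, succ_nsmul]; exact ih.mul hD hf

end Leading

/-- By Dickson's lemma, an element `m` such that all `d + n m` lie in a finitely generated
saturated monoid `S` lies in `S`. -/
lemma IsToricMonoid.mem_of_forall_add_nsmul_mem {S : AddSubmonoid M} (hS : IsToricMonoid S)
    {d m : M} (h : ∀ n : ℕ, d + n • m ∈ S) : m ∈ S := by
  obtain ⟨G, hG⟩ := hS.fg
  have h' : ∀ n : ℕ, ∃ c : G → ℕ, ∑ i, c i • (i : M) = d + n • m := fun n => by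
    have := h n
    rw [← hG] at this
    rw [AddSubmonoid.mem_closure_finset] at this
    obtain ⟨c, hc, h⟩ := this
    refine ⟨fun i => c i, ?_⟩
    rw [← h, ← Finset.sum_coe_sort G (fun i => c i • i)]
  choose c hc using h'
  obtain ⟨p, q, hpq, hle⟩ := wellQuasiOrdered_le c
  have h1 : (q - p) • m = ∑ i, (c q i - c p i) • (i : M) := by
    have h2 : ∑ i, (c q i - c p i) • (i : M) + ∑ i, c p i • (i : M) = ∑ i, c q i • (i : M) := by
      rw [← Finset.sum_add_distrib]
      exact Finset.sum_congr rfl fun i _ => by rw [← add_smul, Nat.sub_add_cancel (hle i)]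
    rw [hc, hc] at h2
    have h3 : q • m = (q - p) • m + p • m := by rw [← add_smul, Nat.sub_add_cancel hpq.le]
    rw [h3] at h2
    rw [add_left_comm d] at h2
    exact (add_right_cancel h2).symm
  have h2 : (q - p) • m ∈ S := by
    rw [h1]
    refine S.sum_mem fun i _ => S.nsmul_mem ?_ _
    rw [← hG]
    exact AddSubmonoid.subset_closure i.2
  exact (hS.saturated h2).resolve_left (by omega)

lemma IsToricMonoid.exists_eq_add {S : AddSubmonoid M} (hS : IsToricMonoid S) (m : M) :
    ∃ p q : S, (p : M) = m + q := by
  have hm : m ∈ AddSubgroup.closure (S : Set M) := hS.generates ▸ AddSubgroup.mem_top m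
  induction hm using AddSubgroup.closure_induction with
  | mem x hx => exact ⟨⟨x, hx⟩, 0, by simp⟩
  | zero => exact ⟨0, 0, by simp⟩
  | add x y _ _ hx hy =>
    obtain ⟨p, q, h⟩ := hx
    obtain ⟨p', q', h'⟩ := hy
    exact ⟨p + p', q + q', by simp only [AddSubmonoid.coe_add, h, h']; abel⟩
  | neg x _ hx =>
    obtain ⟨p, q, h⟩ := hx
    exact ⟨q, p, by rw [h]; abel⟩

/-- A lattice carries a total ordering compatible with addition. -/
lemma exists_injective_lex (M : Type*) [AddCommGroup M] [Module.Free ℤ M] [Module.Finite ℤ M] :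
    ∃ D : M →+ Lex (Fin (Module.finrank ℤ M) →₀ ℤ), Function.Injective D :=
  ⟨{ toFun := fun m => toLex ((Module.finBasis ℤ M).repr m)
     map_zero' := by simp
     map_add' := fun x y => by simp }, toLex.injective.comp (Module.finBasis ℤ M).repr.injective⟩

/-- The leading exponent `a` of an element `f` of `k[M]` that is almost integral over `k[S]` lies in
`S`: with `d` the leading exponent of `r`, all `d + n a` are in `S`. -/
lemma IsToricMonoid.leadingExponent_mem {S : AddSubmonoid M} (hS : IsToricMonoid S)
    {Γ : Type*} [AddCommGroup Γ] [LinearOrder Γ] [IsOrderedAddMonoid Γ] {D : M →+ Γ}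
    (hD : Function.Injective D) {f : AddMonoidAlgebra k M} {a : M}
    {r : AddMonoidAlgebra k S} (hr : r ≠ 0)
    (hf : ∀ n, ∃ g, AddMonoidAlgebra.mapDomain S.subtype g =
      AddMonoidAlgebra.mapDomain S.subtype r * f ^ n)
    (ha : IsLeadingExponent D f a) : a ∈ S := by
  classical
  have hr0 : AddMonoidAlgebra.mapDomain S.subtype r ≠ 0 := fun h =>
    hr (AddMonoidAlgebra.mapDomain_injective S.subtype_injective
      (h.trans (AddMonoidAlgebra.mapDomain_zero _).symm))
  obtain ⟨d, hd⟩ := exists_isLeadingExponent D hr0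
  refine hS.mem_of_forall_add_nsmul_mem (d := d) fun n => ?_
  obtain ⟨g, hg⟩ := hf n
  have h1 := (hd.mul hD (ha.pow hD n)).1
  rw [← hg] at h1
  obtain ⟨s, -, hs⟩ := Finset.mem_image.mp (Finsupp.mapDomain_support h1)
  rw [← hs]
  exact s.2

lemma coeff_sub_single (f : AddMonoidAlgebra k M) (a : M) :
    (f - .single a (f.coeff a)).coeff = f.coeff.erase a := by
  classical
  ext x
  rw [AddMonoidAlgebra.coeff_sub, AddMonoidAlgebra.coeff_single, Finsupp.sub_apply]
  by_cases hx : x = a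
  · rw [hx, Finsupp.single_eq_same, Finsupp.erase_same, sub_self]
  · rw [Finsupp.single_eq_of_ne hx, Finsupp.erase_ne hx, sub_zero]

/-- A subring of `k[M]` containing `k[S]`, in which all leading exponents lie in `S`, is `k[S]`:
leading terms can be subtracted one after the other. -/
lemma mem_range_mapDomain_of_leadingExponent_mem {S : AddSubmonoid M} {Γ : Type*} [LinearOrder Γ]
    {D : M → Γ} {C : Subring (AddMonoidAlgebra k M)} (hSC : ∀ s ∈ S, ∀ c, .single s c ∈ C)
    (hlead : ∀ f ∈ C, ∀ a, IsLeadingExponent D f a → a ∈ S) (f : AddMonoidAlgebra k M)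
    (hf : f ∈ C) :
    ∃ g : AddMonoidAlgebra k S, AddMonoidAlgebra.mapDomain S.subtype g = f := by
  classical
  induction hn : f.coeff.support.card using Nat.strong_induction_on generalizing f with | _ n ih
  by_cases hf0 : f = 0
  · exact ⟨0, by rw [hf0, AddMonoidAlgebra.mapDomain_zero]⟩
  obtain ⟨a, ha⟩ := exists_isLeadingExponent D hf0
  have haS := hlead f hf a ha
  have hlt : (f - .single a (f.coeff a)).coeff.support.card < n := by
    rw [coeff_sub_single f a, Finsupp.support_erase, ← hn]
    exact Finset.card_erase_lt_of_mem ha.1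
  obtain ⟨g, hg⟩ := ih _ hlt _ (C.sub_mem hf (hSC a haS _)) rfl
  exact ⟨g + .single ⟨a, haS⟩ (f.coeff a), by
    rw [AddMonoidAlgebra.mapDomain_add, hg, AddMonoidAlgebra.mapDomain_single,
      AddSubmonoid.subtype_apply, sub_add_cancel]⟩

/-- The coordinate ring of an affine toric variety is integrally closed. -/
theorem IsToricMonoid.isIntegrallyClosed [Module.Free ℤ M] [Module.Finite ℤ M] {S : AddSubmonoid M}
    (hS : IsToricMonoid S) : IsIntegrallyClosed (AddMonoidAlgebra k S) := by
  let : Algebra (AddMonoidAlgebra k S) (AddMonoidAlgebra k M) :=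
    (AddMonoidAlgebra.mapDomainRingHom k S.subtype).toAlgebra
  have hinj : Function.Injective (algebraMap (AddMonoidAlgebra k S) (AddMonoidAlgebra k M)) :=
    AddMonoidAlgebra.mapDomain_injective S.subtype_injective
  have hloc := isLocalization_monomials (k := k) S.subtype S.subtype_injective hS.exists_eq_add
  have hnzd : MonoidHom.mrange (AddMonoidAlgebra.of k S) ≤
      nonZeroDivisors (AddMonoidAlgebra k S) := by
    rintro _ ⟨p, rfl⟩
    refine mem_nonZeroDivisors_of_ne_zero fun h => ?_
    exact AddMonoidAlgebra.single_ne_zero.mpr one_ne_zero h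
  have hdom : IsDomain (AddMonoidAlgebra k M) :=
    IsLocalization.isDomain_of_le_nonZeroDivisors _ hnzd
  have := isIntegrallyClosed_groupAlgebra k M
  have hinj' : Function.Injective (algebraMap (AddMonoidAlgebra k S)
      (FractionRing (AddMonoidAlgebra k M))) := by
    rw [IsScalarTower.algebraMap_eq _ (AddMonoidAlgebra k M)]
    exact (IsFractionRing.injective (AddMonoidAlgebra k M) _).comp hinj
  let j : FractionRing (AddMonoidAlgebra k S) →ₐ[AddMonoidAlgebra k S]
      FractionRing (AddMonoidAlgebra k M) := IsFractionRing.liftAlgHom (g := Algebra.ofId _ _) hinj'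
  -- an integral element of the fraction field is in `k[M]`, as that is normal; its powers have a
  -- common denominator in `k[S]`, so the leading exponents argument applies
  rw [isIntegrallyClosed_iff (FractionRing (AddMonoidAlgebra k S))]
  intro x hx
  obtain ⟨y, hy⟩ := IsIntegrallyClosed.isIntegral_iff.mp
    ((hx.map j).tower_top (A := AddMonoidAlgebra k M))
  have hy' : IsIntegral (AddMonoidAlgebra k S) y := by
    have := hx.map j
    rw [← hy] at this
    exact (isIntegral_algebraMap_iff (IsFractionRing.injective _ _)).mp this
  have halg : ∀ f, algebraMap (AddMonoidAlgebra k S) (AddMonoidAlgebra k M) f =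
    AddMonoidAlgebra.mapDomain S.subtype f := fun f => rfl
  obtain ⟨D, hD⟩ := exists_injective_lex M
  obtain ⟨g, hg⟩ := mem_range_mapDomain_of_leadingExponent_mem (D := D)
    (C := (completeIntegralClosure (AddMonoidAlgebra k S) (AddMonoidAlgebra k M)).toSubring)
    (fun s hs c => by
      have : (AddMonoidAlgebra.single s c : AddMonoidAlgebra k M) =
          algebraMap (AddMonoidAlgebra k S) (AddMonoidAlgebra k M) (.single ⟨s, hs⟩ c) := by
        rw [halg, AddMonoidAlgebra.mapDomain_single, AddSubmonoid.subtype_apply]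
      rw [this]
      exact Subalgebra.algebraMap_mem _ _)
    (fun f ⟨r, hr, hrf⟩ a ha => by
      refine hS.leadingExponent_mem hD (nonZeroDivisors.ne_zero hr) (fun n => ?_) ha
      obtain ⟨g, hg⟩ := hrf n
      rw [Algebra.smul_def] at hg
      exact ⟨g, hg⟩) y (hy'.isAlmostIntegral_of_isLocalization _ hnzd)
  refine ⟨g, j.toRingHom.injective ?_⟩
  change j (algebraMap _ _ g) = j x
  rw [← hy, ← hg, AlgHom.commutes]
  rfl

end Normal

/-! ### Normal domains and primes whose local ring is a discrete valuation ring -/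

section Hartogs

open IsLocalRing

/-- If `g ∉ O` multiplies the maximal ideal of a normal Noetherian local domain `O` into `O`, then
`O` is a principal ideal ring: otherwise `g` maps the maximal ideal to itself, so is integral. -/
lemma isPrincipalIdealRing_of_mul_maximalIdeal {O K : Type*} [CommRing O] [IsDomain O]
    [IsLocalRing O] [IsNoetherianRing O] [IsIntegrallyClosed O] [Field K] [Algebra O K]
    [IsFractionRing O K] (g : K) (hg : g ∉ (algebraMap O K).range)
    (h : ∀ x ∈ maximalIdeal O, g * algebraMap O K x ∈ (algebraMap O K).range) :
    IsPrincipalIdealRing O := by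
  have hinj : Function.Injective (algebraMap O K) := IsFractionRing.injective O K
  by_cases hunit : ∃ x ∈ maximalIdeal O, g * algebraMap O K x = 1
  · obtain ⟨x, hx, hgx⟩ := hunit
    refine ((tfae_of_isNoetherianRing_of_isLocalRing_of_isDomain O).out 4 0).mp ?_
    refine ⟨x, le_antisymm (fun y hy => ?_) ?_⟩
    · obtain ⟨z, hz⟩ := h y hy
      refine Submodule.mem_span_singleton.mpr ⟨z, hinj ?_⟩
      rw [smul_eq_mul, map_mul, hz]
      linear_combination algebraMap O K y * hgx
    · rwa [Submodule.span_singleton_le_iff_mem]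
  · exfalso
    have hmem : ∀ x ∈ maximalIdeal O, ∃ z ∈ maximalIdeal O,
        algebraMap O K z = g * algebraMap O K x := fun x hx => by
      obtain ⟨z, hz⟩ := h x hx
      refine ⟨z, ?_, hz⟩
      rw [mem_maximalIdeal, mem_nonunits_iff]
      intro hzu
      obtain ⟨w, hw⟩ := hzu.exists_right_inv
      refine hunit ⟨x * w, Ideal.mul_mem_right _ _ hx, ?_⟩
      rw [map_mul, ← mul_assoc, ← hz, ← map_mul, hw, map_one]
    have hne : maximalIdeal O ≠ ⊥ := fun hbot => by
      have hfield := isField_iff_maximalIdeal_eq.mpr hbot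
      obtain ⟨a, b, hb, rfl⟩ := IsFractionRing.div_surjective (A := O) g
      obtain ⟨c, hc⟩ := hfield.mul_inv_cancel (nonZeroDivisors.ne_zero hb)
      refine hg ⟨a * c, ?_⟩
      have hb' : algebraMap O K b ≠ 0 :=
        (map_ne_zero_iff _ hinj).mpr (nonZeroDivisors.ne_zero hb)
      rw [eq_div_iff hb', ← map_mul, mul_assoc, mul_comm c, hc, mul_one]
    have hint : IsIntegral O g := by
      refine isIntegral_of_smul_mem_submodule (M := K)
        (Submodule.map (Algebra.linearMap O K) (maximalIdeal O)) ?_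
        ((IsNoetherian.noetherian (maximalIdeal O)).map _) g ?_
      · exact fun h => hne (Submodule.map_injective_of_injective (f := Algebra.linearMap O K) hinj
          (h.trans (Submodule.map_bot _).symm))
      · rintro _ ⟨x, hx, rfl⟩
        obtain ⟨z, hz, hzx⟩ := hmem x hx
        exact ⟨z, hz, hzx⟩
    exact hg (IsIntegrallyClosed.isIntegral_iff.mp hint)

/-- If `f` is not regular at the prime `v`, there is an associated prime of the ideal of
denominators of `f` at which `f` is not regular; it is `p = {a | a g ∈ A_v}` for a suitable `g`. -/
lemma exists_prime_eq_colon {A K : Type*} [CommRing A] [IsNoetherianRing A] [Field K]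
    [Algebra A K] (v : Ideal A) [v.IsPrime] (f : K)
    (hf : ∀ a b, b ∉ v → f * algebraMap A K b ≠ algebraMap A K a) :
    ∃ (p : Ideal A) (g : K), p.IsPrime ∧ p ≤ v ∧
      (∀ a b, b ∉ p → f * algebraMap A K b ≠ algebraMap A K a) ∧
      (∀ a, a ∈ p ↔ ∃ b c, b ∉ v ∧ g * algebraMap A K a * algebraMap A K b = algebraMap A K c) := by
  let Av : Submodule A K :=
    { carrier := {x | ∃ b c, b ∉ v ∧ x * algebraMap A K b = algebraMap A K c}
      zero_mem' := ⟨1, 0, fun h => v.ne_top_iff_one.mp (Ideal.IsPrime.ne_top ‹_›) h, by simp⟩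
      add_mem' := by
        rintro x y ⟨b, c, hb, h⟩ ⟨b', c', hb', h'⟩
        refine ⟨b * b', c * b' + c' * b, fun hbb => ?_, ?_⟩
        · exact (Ideal.IsPrime.mem_or_mem ‹_› hbb).elim hb hb'
        · simp only [map_add, map_mul]
          linear_combination algebraMap A K b' * h + algebraMap A K b * h'
      smul_mem' := by
        rintro a x ⟨b, c, hb, h⟩
        refine ⟨b, a * c, hb, ?_⟩
        rw [Algebra.smul_def, map_mul]
        linear_combination algebraMap A K a * h }
  have hAv : ∀ x, x ∈ Av ↔ ∃ b c, b ∉ v ∧ x * algebraMap A K b = algebraMap A K c :=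
    fun x => Iff.rfl
  have hf0 : (Av.mkQ f) ≠ 0 := by
    rw [Ne, Submodule.mkQ_apply, Submodule.Quotient.mk_eq_zero, hAv]
    rintro ⟨b, c, hb, h⟩
    exact hf c b hb h
  obtain ⟨p, hp, hle⟩ := exists_le_isAssociatedPrime_of_isNoetherianRing A _ hf0
  obtain ⟨hprime, y, hy⟩ := Submodule.isAssociatedPrime_iff.mp hp
  obtain ⟨g, rfl⟩ := Av.mkQ_surjective y
  have hcolon : ∀ (x : K) (a : A), a ∈ (⊥ : Submodule A (K ⧸ Av)).colon {Av.mkQ x} ↔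
      ∃ b c, b ∉ v ∧ x * algebraMap A K a * algebraMap A K b = algebraMap A K c := fun x a => by
    rw [Submodule.mem_colon_singleton, ← map_smul, Submodule.mem_bot, Submodule.mkQ_apply,
      Submodule.Quotient.mk_eq_zero, hAv, Algebra.smul_def, mul_comm (algebraMap A K a)]
  have hmem : ∀ a, a ∈ p ↔
      ∃ b c, b ∉ v ∧ g * algebraMap A K a * algebraMap A K b = algebraMap A K c := fun a => by
    rw [hy, hcolon]
  have h1 : (1 : A) ∉ p := fun h => p.ne_top_iff_one.mp hprime.ne_top h
  refine ⟨p, g, hprime, fun a ha => ?_, fun a b hb hab => hb (hle ?_), hmem⟩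
  · by_contra hav
    obtain ⟨b, c, hb, h⟩ := (hmem a).mp ha
    refine h1 ((hmem 1).mpr ⟨a * b, c, fun hab => ?_, ?_⟩)
    · exact (Ideal.IsPrime.mem_or_mem ‹_› hab).elim hav hb
    · rw [← h, map_mul, map_one]; ring
  · rw [hcolon]
    exact ⟨1, a, fun h => v.ne_top_iff_one.mp (Ideal.IsPrime.ne_top ‹_›) h, by
      rw [map_one, mul_one, hab]⟩

/-- A normal Noetherian domain `A` is, locally at `v`, the intersection of its local rings at those
primes `p ≤ v` at which it is a principal ideal ring. -/
lemma exists_isPrincipalIdealRing_of_not_regular {A K : Type*} [CommRing A] [IsDomain A]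
    [IsNoetherianRing A] [IsIntegrallyClosed A] [Field K]
    [Algebra A K] [IsFractionRing A K] (v : Ideal A) [v.IsPrime] (f : K)
    (hf : ∀ a b, b ∉ v → f * algebraMap A K b ≠ algebraMap A K a) :
    ∃ (p : Ideal A) (_ : p.IsPrime), p ≤ v ∧
      (∀ a b, b ∉ p → f * algebraMap A K b ≠ algebraMap A K a) ∧
      IsPrincipalIdealRing (Localization.AtPrime p) := by
  obtain ⟨p, g, hp, hpv, hfp, hmem⟩ := exists_prime_eq_colon v f hf
  refine ⟨p, hp, hpv, hfp, ?_⟩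
  let O := Localization.AtPrime p
  let j : O →+* K := IsLocalization.lift (M := p.primeCompl) (g := algebraMap A K) fun y =>
    ((map_ne_zero_iff _ (IsFractionRing.injective A K)).mpr
      (ne_of_mem_of_not_mem p.zero_mem y.2).symm).isUnit
  let : Algebra O K := j.toAlgebra
  have hj : ∀ a, algebraMap O K (algebraMap A O a) = algebraMap A K a := fun a =>
    IsLocalization.lift_eq _ a
  have : IsScalarTower A O K := .of_algebraMap_eq fun a => (hj a).symm
  have : IsFractionRing O K :=
    IsFractionRing.isFractionRing_of_isDomain_of_isLocalization p.primeCompl O K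
  have hOn : IsNoetherianRing O := IsLocalization.isNoetherianRing p.primeCompl O inferInstance
  have hOi : IsIntegrallyClosed O :=
    isIntegrallyClosed_of_isLocalization O p.primeCompl p.primeCompl_le_nonZeroDivisors
  have hunit : ∀ b, b ∉ v → b ∉ p := fun b hb hbp => hb (hpv hbp)
  refine isPrincipalIdealRing_of_mul_maximalIdeal (K := K) g ?_ fun x hx => ?_
  · rintro ⟨y, hy⟩
    obtain ⟨⟨a, b⟩, hab⟩ := IsLocalization.surj p.primeCompl y
    refine b.2 ((hmem b).mpr ⟨1, a, fun h => v.ne_top_iff_one.mp (Ideal.IsPrime.ne_top ‹_›) h, ?_⟩)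
    rw [map_one, mul_one, ← hy, ← hj, ← map_mul, hab, hj]
  · obtain ⟨⟨a, s⟩, has⟩ := IsLocalization.surj p.primeCompl x
    have ha : a ∈ p := by
      rw [← IsLocalization.AtPrime.to_map_mem_maximal_iff O p a, ← has]
      exact Ideal.mul_mem_right _ _ hx
    obtain ⟨b, c, hb, h⟩ := (hmem a).mp ha
    have hsb : (s : A) * b ∈ p.primeCompl := p.primeCompl.mul_mem s.2 (hunit b hb)
    refine ⟨IsLocalization.mk' O c ⟨s * b, hsb⟩, ?_⟩
    have h1 : algebraMap A K (s * b) ≠ 0 :=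
      (map_ne_zero_iff _ (IsFractionRing.injective A K)).mpr fun h => hsb (h ▸ p.zero_mem)
    apply mul_right_cancel₀ h1
    rw [← hj, ← map_mul, IsLocalization.mk'_spec (M := p.primeCompl) O c ⟨s * b, hsb⟩, hj, ← h, hj,
      map_mul]
    have h2 : algebraMap O K x * algebraMap A K s = algebraMap A K a := by
      rw [← hj, ← hj, ← map_mul]
      exact congrArg (algebraMap O K) has
    linear_combination -(g * algebraMap A K b) * h2

end Hartogs

/-! ### Monomial uniformizers -/

section Uniformizer

open IsLocalRing

variable {k M : Type u} [Field k] [AddCommGroup M]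

/-- The ideal `q` generated by the monomials in a prime `p` of `k[S]` is prime: the quotient is the
monoid algebra of a face of `S`. -/
lemma exists_prime_monomial [Module.Free ℤ M] {S : AddSubmonoid M}
    (p : Ideal (AddMonoidAlgebra k S)) [p.IsPrime] :
    ∃ q : Ideal (AddMonoidAlgebra k S), q.IsPrime ∧
      ∀ f, f ∈ q ↔ ∀ s ∈ f.coeff.support, (.single s 1 : AddMonoidAlgebra k S) ∈ p := by
  classical
  have hmul : ∀ s t : S, (.single (s + t) 1 : AddMonoidAlgebra k S) ∈ p ↔
      .single s 1 ∈ p ∨ .single t 1 ∈ p := fun s t => by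
    rw [← Ideal.IsPrime.mul_mem_iff_mem_or_mem ‹p.IsPrime›,
      AddMonoidAlgebra.single_mul_single, one_mul]
  have h1 : (.single 0 1 : AddMonoidAlgebra k S) ∉ p :=
    fun h => p.ne_top_iff_one.mp (Ideal.IsPrime.ne_top ‹_›) h
  let F : Multiplicative S →* AddMonoidAlgebra k S :=
    { toFun := fun s =>
        if (.single s.toAdd 1 : AddMonoidAlgebra k S) ∈ p then 0 else .single s.toAdd 1
      map_one' := by simp [h1, AddMonoidAlgebra.one_def]
      map_mul' := fun s t => by
        simp only [toAdd_mul, hmul]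
        by_cases hs : (.single s.toAdd 1 : AddMonoidAlgebra k S) ∈ p
        · simp [hs]
        · by_cases ht : (.single t.toAdd 1 : AddMonoidAlgebra k S) ∈ p
          · simp [ht]
          · simp [hs, ht, AddMonoidAlgebra.single_mul_single] }
  let φ := AddMonoidAlgebra.lift k (AddMonoidAlgebra k S) S F
  have hφ : ∀ f s, (φ f).coeff s =
      if (.single s 1 : AddMonoidAlgebra k S) ∈ p then 0 else f.coeff s := fun f s => by
    induction f using AddMonoidAlgebra.induction_linear with
    | zero => simp
    | add f g hf hg =>
      rw [map_add, AddMonoidAlgebra.coeff_add, Finsupp.add_apply, hf, hg]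
      split_ifs <;> simp
    | single t r =>
      simp only [φ, AddMonoidAlgebra.lift_single, F, MonoidHom.coe_mk, OneHom.coe_mk, toAdd_ofAdd]
      by_cases hst : s = t
      · subst hst; split_ifs <;> simp
      · split_ifs <;> simp [Finsupp.single_eq_of_ne hst]
  -- `q` is the kernel of the projection `φ` onto the span of the monomials not in `p`
  refine ⟨RingHom.ker φ, RingHom.ker_isPrime φ, fun f => ?_⟩
  rw [RingHom.mem_ker]
  constructor
  · intro h s hs
    by_contra hsp
    have := hφ f s
    rw [h, if_neg hsp] at this
    exact Finsupp.mem_support_iff.mp hs this.symm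
  · intro h
    ext s
    rw [hφ]
    split_ifs with hs
    · rfl
    · by_contra hne
      exact hs (h s (Finsupp.mem_support_iff.mpr hne))

/-- Let `p` be a prime of `k[S]` containing a monomial, at which the local ring `O` is a principal
ideal ring. Then some monomial is a uniformizer of `O`, so each nonzero element of `O` is a unit
times a monomial. -/
lemma exists_unit_mul_monomial [Module.Free ℤ M] {S : AddSubmonoid M}
    (p : Ideal (AddMonoidAlgebra k S)) [p.IsPrime]
    (O : Type*) [CommRing O] [IsDomain O] [IsLocalRing O] [IsPrincipalIdealRing O]
    [Algebra (AddMonoidAlgebra k S) O] [IsLocalization.AtPrime O p]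
    (hp : ∃ s : S, (.single s 1 : AddMonoidAlgebra k S) ∈ p) (x : O) (hx : x ≠ 0) :
    ∃ (w : Oˣ) (s : S), x = w * algebraMap (AddMonoidAlgebra k S) O (.single s 1) := by
  set A := AddMonoidAlgebra k S with hA
  have hinj : Function.Injective (algebraMap A O) :=
    IsLocalization.injective O p.primeCompl_le_nonZeroDivisors
  have hmono : ∀ s : S, algebraMap A O (.single s 1) ≠ 0 := fun s => by
    rw [map_ne_zero_iff _ hinj]
    exact AddMonoidAlgebra.single_ne_zero.mpr one_ne_zero
  obtain ⟨s₀, hs₀⟩ := hp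
  have hmax : ∀ a, algebraMap A O a ∈ maximalIdeal O ↔ a ∈ p :=
    fun a => IsLocalization.AtPrime.to_map_mem_maximal_iff O p a
  have hnf : maximalIdeal O ≠ ⊥ := fun h => by
    have := (hmax _).mpr hs₀
    rw [h, Ideal.mem_bot] at this
    exact hmono s₀ this
  have hdvr : IsDiscreteValuationRing O := { not_a_field' := hnf }
  -- the maximal ideal is generated by monomials
  obtain ⟨q, hq, hqmem⟩ := exists_prime_monomial p
  have hqp : q ≤ p := fun f hf => by
    have hf' := (hqmem f).mp hf
    rw [← AddMonoidAlgebra.sum_coeff_single f]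
    refine p.sum_mem fun s hs => ?_
    have : (.single s (f.coeff s) : A) = .single 0 (f.coeff s) * .single s 1 := by
      simp [AddMonoidAlgebra.single_mul_single]
    rw [this]
    exact p.mul_mem_left _ (hf' s hs)
  have hpq : p ≤ q := by
    have hdisj : Disjoint (p.primeCompl : Set A) (q : Set A) :=
      Set.disjoint_left.mpr fun a ha haq => ha (hqp haq)
    have hprime := IsLocalization.isPrime_of_isPrime_disjoint p.primeCompl O q hq hdisj
    have hs₀q : algebraMap A O (.single s₀ 1) ∈ q.map (algebraMap A O) := by
      refine Ideal.mem_map_of_mem _ ((hqmem _).mpr fun s hs => ?_)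
      have : s = s₀ := by
        simpa using hs
      rwa [this]
    have hne : q.map (algebraMap A O) ≠ ⊥ := fun h => by
      rw [h, Ideal.mem_bot] at hs₀q
      exact hmono s₀ hs₀q
    have heq : q.map (algebraMap A O) = maximalIdeal O := eq_maximalIdeal (hprime.isMaximal hne)
    intro f hf
    rw [← IsLocalization.under_map_of_isPrime_disjoint p.primeCompl O hq hdisj, Ideal.mem_comap,
      heq, hmax]
    exact hf
  obtain ⟨s, hs, hs2⟩ : ∃ s : S, (.single s 1 : A) ∈ p ∧
      algebraMap A O (.single s 1) ∉ maximalIdeal O ^ 2 := by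
    by_contra! hcon
    have hle : maximalIdeal O ≤ maximalIdeal O ^ 2 := by
      rw [← IsLocalization.AtPrime.map_eq_maximalIdeal p O, Ideal.map_le_iff_le_comap,
        IsLocalization.AtPrime.map_eq_maximalIdeal p O]
      intro f hf
      have hf' := (hqmem f).mp (hpq hf)
      rw [Ideal.mem_comap, ← AddMonoidAlgebra.sum_coeff_single f, Finsupp.sum, map_sum]
      refine Ideal.sum_mem _ fun s hs => ?_
      have : (.single s (f.coeff s) : A) = .single 0 (f.coeff s) * .single s 1 := by
        simp [AddMonoidAlgebra.single_mul_single]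
      rw [this, map_mul]
      exact Ideal.mul_mem_left _ _ (hcon s (hf' s hs))
    obtain ⟨π, hπ⟩ := IsDiscreteValuationRing.exists_irreducible O
    have hπm : π ∈ maximalIdeal O := hπ.not_isUnit
    have := hle hπm
    rw [hπ.maximalIdeal_eq, Ideal.span_singleton_pow, Ideal.mem_span_singleton] at this
    obtain ⟨c, hc⟩ := this
    refine hπ.not_isUnit (IsUnit.of_mul_eq_one c ?_)
    refine mul_left_cancel₀ hπ.ne_zero ?_
    linear_combination -hc
  have hirr : Irreducible (algebraMap A O (.single s 1)) := by
    obtain ⟨π, hπ⟩ := IsDiscreteValuationRing.exists_irreducible O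
    have hsm := (hmax _).mpr hs
    rw [hπ.maximalIdeal_eq, Ideal.mem_span_singleton] at hsm
    obtain ⟨c, hc⟩ := hsm
    have hcu : IsUnit c := by
      by_contra hcu
      refine hs2 ?_
      rw [hc, pow_two]
      exact Ideal.mul_mem_mul hπ.not_isUnit hcu
    rw [hc]
    exact (associated_mul_unit_right π c hcu).irreducible hπ
  obtain ⟨n, w, hw⟩ := IsDiscreteValuationRing.associated_pow_irreducible hx hirr
  refine ⟨w⁻¹, n • s, ?_⟩
  have : (.single (n • s) 1 : A) = .single s 1 ^ n := by simp [AddMonoidAlgebra.single_pow]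
  rw [this, map_pow, ← hw, mul_comm x, ← mul_assoc, Units.inv_mul, one_mul]

end Uniformizer

/-! ### Logarithmic derivations along formally étale maps -/

section Derivations

open TensorProduct

variable {k A B N : Type*} [CommRing k] [CommRing A] [CommRing B] [Algebra k B]
  [Algebra A B] [AddCommGroup N] [Module k N] [Module B N]

/-- Derivations along a formally unramified map are determined by their values on the base. -/
lemma derivation_ext_of_formallyUnramified [Algebra.FormallyUnramified A B]
    {D D' : Derivation k B N}
    (h : ∀ a, D (algebraMap A B a) = D' (algebraMap A B a)) : D = D' := by
  let : Module A N := Module.compHom N (algebraMap A B)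
  have : IsScalarTower A B N := ⟨fun a b n => by
    rw [Algebra.smul_def, mul_smul]; rfl⟩
  let E : Derivation A B N := Derivation.mk'
    { toFun := fun b => (D - D') b
      map_add' := fun x y => map_add _ x y
      map_smul' := fun a x => by
        have : (D - D') (algebraMap A B a) = 0 := by rw [Derivation.sub_apply, h, sub_self]
        rw [Algebra.smul_def, Derivation.leibniz, this, smul_zero, add_zero]
        rfl }
    fun x y => (D - D').leibniz x y
  ext b
  have h1 : (D - D') b = E.liftKaehlerDifferential (KaehlerDifferential.D A B b) :=
    (E.liftKaehlerDifferential_comp_D b).symm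
  rw [Subsingleton.elim (KaehlerDifferential.D A B b) 0, map_zero, Derivation.sub_apply] at h1
  exact sub_eq_zero.mp h1

variable [Algebra k A] [IsScalarTower k A B] [IsScalarTower k B N]

lemma exists_derivation_extension [Algebra.FormallyEtale A B] [Module A N] [IsScalarTower A B N]
    [IsScalarTower k A N] (D : Derivation k A N) :
    ∃ D' : Derivation k B N, ∀ a, D' (algebraMap A B a) = D a := by
  let f : B ⊗[A] Ω[A⁄k] →ₗ[B] N := LinearMap.liftBaseChange B D.liftKaehlerDifferential
  let e := (KaehlerDifferential.tensorKaehlerEquivOfFormallyEtale k A B).symm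
  refine ⟨(f ∘ₗ e.toLinearMap).compDer (KaehlerDifferential.D k B), fun a => ?_⟩
  change f ((KaehlerDifferential.tensorKaehlerEquivOfFormallyEtale k A B).symm
    (KaehlerDifferential.D k B (algebraMap A B a))) = _
  rw [KaehlerDifferential.tensorKaehlerEquivOfFormallyEtale_symm_D_algebraMap]
  simp [f]

end Derivations

section LogDerivations

variable {k M ι : Type*} [CommRing k] [AddCommGroup M] {S : AddSubmonoid M}

/-- The derivation of `k[S]` attached to an additive function on `S`. -/
lemma exists_derivation_monoidAlgebra (h : S →+ ℤ) :
    ∃ D : Derivation k (AddMonoidAlgebra k S) (AddMonoidAlgebra k S),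
      ∀ s, D (.single s 1) = (h s : AddMonoidAlgebra k S) * .single s 1 := by
  let L : AddMonoidAlgebra k S →ₗ[k] AddMonoidAlgebra k S :=
    { toFun := fun f => f.coeff.sum fun s r => .single s ((h s : k) * r)
      map_add' := fun f g => by
        rw [AddMonoidAlgebra.coeff_add, Finsupp.sum_add_index'] <;> intros <;>
          simp [mul_add, AddMonoidAlgebra.single_add]
      map_smul' := fun c f => by
        rw [AddMonoidAlgebra.coeff_smul, Finsupp.sum_smul_index' (by simp), RingHom.id_apply,
          Finsupp.smul_sum]
        refine Finset.sum_congr rfl fun s _ => ?_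
        beta_reduce
        rw [AddMonoidAlgebra.smul_single, smul_eq_mul, smul_eq_mul, mul_left_comm] }
  have hL : ∀ s r, L (.single s r) = .single s ((h s : k) * r) := fun s r => by
    change Finsupp.sum (AddMonoidAlgebra.single s r : AddMonoidAlgebra k S).coeff
      (fun s r => AddMonoidAlgebra.single s ((h s : k) * r)) = _
    rw [AddMonoidAlgebra.coeff_single, Finsupp.sum_single_index (by simp)]
  refine ⟨Derivation.mk' L fun f g => ?_, fun s => ?_⟩
  · induction f using AddMonoidAlgebra.induction_linear with
    | zero => simp
    | add f f' hf hf' => rw [add_mul, map_add, hf, hf', map_add, smul_add, add_smul]; abel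
    | single s r =>
      induction g using AddMonoidAlgebra.induction_linear with
      | zero => simp
      | add f f' hf hf' => rw [mul_add, map_add, hf, hf', map_add, smul_add, add_smul]; abel
      | single t r' =>
        rw [AddMonoidAlgebra.single_mul_single, hL, hL, hL, smul_eq_mul, smul_eq_mul,
          AddMonoidAlgebra.single_mul_single, AddMonoidAlgebra.single_mul_single, add_comm t s,
          ← AddMonoidAlgebra.single_add, map_add]
        congr 1
        push_cast
        ring
  · change L _ = _
    rw [hL, mul_one]
    have : (h s : AddMonoidAlgebra k S) = .single 0 (h s : k) := by
      rw [← map_intCast (algebraMap k (AddMonoidAlgebra k S))]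
      rfl
    rw [this, AddMonoidAlgebra.single_mul_single, zero_add, mul_one]

variable {B : Type*} [CommRing B] [Algebra k B] [Algebra (AddMonoidAlgebra k S) B]
  [IsScalarTower k (AddMonoidAlgebra k S) B]

/-- The logarithmic derivations of `k[S]` extend along formally étale maps. -/
lemma exists_logDerivation [Algebra.FormallyEtale (AddMonoidAlgebra k S) B]
    (b : Module.Basis ι ℤ M) :
    ∃ δ : ι → Derivation k B B, ∀ i (s : S),
      δ i (algebraMap (AddMonoidAlgebra k S) B (.single s 1)) =
        (b.repr s.1 i : B) * algebraMap (AddMonoidAlgebra k S) B (.single s 1) := by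
  have h : ∀ i, ∃ D : Derivation k B B, ∀ s : S,
      D (algebraMap (AddMonoidAlgebra k S) B (.single s 1)) =
        (b.repr s.1 i : B) * algebraMap (AddMonoidAlgebra k S) B (.single s 1) := fun i => by
    obtain ⟨D, hD⟩ := exists_derivation_monoidAlgebra (k := k)
      (((b.coord i).toAddMonoidHom).comp S.subtype)
    obtain ⟨D', hD'⟩ := exists_derivation_extension (B := B)
      ((Algebra.linearMap (AddMonoidAlgebra k S) B).compDer D)
    refine ⟨D', fun s => ?_⟩
    rw [hD']
    change algebraMap _ B (D _) = _
    rw [hD, map_mul, map_intCast]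
    rfl
  choose δ hδ using h
  exact ⟨δ, hδ⟩

variable {N : Type*} [AddCommGroup N] [Module k N] [Module B N]

lemma derivation_ext_monomials [Algebra.FormallyUnramified (AddMonoidAlgebra k S) B]
    {D E : Derivation k B N}
    (h : ∀ s : S, D (algebraMap (AddMonoidAlgebra k S) B (.single s 1)) =
      E (algebraMap (AddMonoidAlgebra k S) B (.single s 1))) : D = E := by
  refine derivation_ext_of_formallyUnramified (A := AddMonoidAlgebra k S) fun a => ?_
  induction a using AddMonoidAlgebra.induction_linear with
  | zero => simp
  | add f g hf hg => rw [map_add, map_add, hf, hg, map_add]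
  | single s r =>
    have : (.single s r : AddMonoidAlgebra k S) = algebraMap k _ r * .single s 1 := by
      simp [AddMonoidAlgebra.single_mul_single]
    rw [this, map_mul, ← IsScalarTower.algebraMap_apply, ← Algebra.smul_def, D.map_smul,
      E.map_smul, h]

variable [IsScalarTower k B N] [Fintype ι]

/-- Expansion of a derivation in terms of the logarithmic derivations. -/
lemma derivation_eq_sum_logDerivation [Algebra.FormallyUnramified (AddMonoidAlgebra k S) B]
    (b : Module.Basis ι ℤ M)
    (δ : ι → Derivation k B B) (hδ : ∀ i (s : S),
      δ i (algebraMap (AddMonoidAlgebra k S) B (.single s 1)) =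
        (b.repr s.1 i : B) * algebraMap (AddMonoidAlgebra k S) B (.single s 1))
    (ω : ι → N) (D : Derivation k B N)
    (h : ∀ s : S, D (algebraMap (AddMonoidAlgebra k S) B (.single s 1)) =
      algebraMap (AddMonoidAlgebra k S) B (.single s 1) • ∑ i, b.repr s.1 i • ω i) (x : B) :
    D x = ∑ i, δ i x • ω i := by
  let E : Derivation k B N := ∑ i, (LinearMap.toSpanSingleton B N (ω i)).compDer (δ i)
  have hE : ∀ x, E x = ∑ i, δ i x • ω i := fun x => by
    rw [show (E x : N) = Derivation.coeFnAddMonoidHom E x from rfl, map_sum, Finset.sum_apply]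
    rfl
  rw [← hE]
  congr 1
  refine derivation_ext_monomials (S := S) fun s => ?_
  rw [h, hE, Finset.smul_sum]
  refine Finset.sum_congr rfl fun i _ => ?_
  rw [hδ, mul_comm, mul_smul, ← Int.cast_smul_eq_zsmul B]

end LogDerivations

section Dlog

variable (k : Type*) [CommRing k] {K : Type*} [Field K] [Algebra k K]

/-- The logarithmic differential `dx / x`. -/
noncomputable def dlog (x : K) : Ω[K⁄k] := x⁻¹ • KaehlerDifferential.D k K x

lemma smul_dlog {x : K} (hx : x ≠ 0) : x • dlog k x = KaehlerDifferential.D k K x := by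
  rw [dlog, smul_smul, mul_inv_cancel₀ hx, one_smul]

lemma dlog_mul {x y : K} (hx : x ≠ 0) (hy : y ≠ 0) : dlog k (x * y) = dlog k x + dlog k y := by
  simp only [dlog, Derivation.leibniz, smul_add, smul_smul]
  rw [add_comm]
  congr 2 <;> field_simp

variable {ι M : Type*} [AddCommGroup M] [Fintype ι]

/-- Logarithmic differentials of characters are integral linear combinations of those of a basis. -/
lemma dlog_character (b : Module.Basis ι ℤ M) (χ : Multiplicative M →* Kˣ) (m : M) :
    dlog k (χ (.ofAdd m) : K) = ∑ i, b.repr m i • dlog k (χ (.ofAdd (b i)) : K) := by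
  let f : M →+ Ω[K⁄k] :=
    AddMonoidHom.mk' (fun m => dlog k (χ (.ofAdd m) : K)) fun x y => by
      rw [ofAdd_add, map_mul, Units.val_mul, dlog_mul k (Units.ne_zero _) (Units.ne_zero _)]
  change f m = _
  conv_lhs => rw [← b.sum_repr m, map_sum]
  exact Finset.sum_congr rfl fun i _ => map_zsmul f _ _

end Dlog

section Extension

variable {M : Type u} [AddCommGroup M] {S : AddSubmonoid M}

/-- A homomorphism from a toric monoid to a group extends to the lattice. -/
lemma IsToricMonoid.exists_extension (hS : IsToricMonoid S) {G : Type*} [CommGroup G] (f : S → G)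
    (hf : ∀ s t, f (s + t) = f s * f t) :
    ∃ F : Multiplicative M →* G, ∀ s : S, F (.ofAdd s.1) = f s := by
  choose p q hpq using hS.exists_eq_add
  have key : ∀ (m : M) (s t : S), (s : M) = m + t → f (p m) / f (q m) = f s / f t :=
      fun m s t h => by
    rw [div_eq_div_iff_mul_eq_mul, ← hf, ← hf]
    congr 1
    ext
    rw [AddSubmonoid.coe_add, AddSubmonoid.coe_add, hpq, h]
    abel
  have hf0 : f 0 = 1 := by simpa using hf 0 0
  refine ⟨MonoidHom.mk' (fun m => f (p m.toAdd) / f (q m.toAdd)) fun x y => ?_, fun s => ?_⟩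
  · rw [key _ (p x.toAdd + p y.toAdd) (q x.toAdd + q y.toAdd), hf, hf, mul_div_mul_comm]
    rw [AddSubmonoid.coe_add, AddSubmonoid.coe_add, hpq, hpq, toAdd_mul]
    abel
  · change f (p s.1) / f (q s.1) = _
    rw [key s.1 s 0 (by simp), hf0, div_one]

/-- The characters of the torus as elements of a field containing `k[S]`. -/
lemma IsToricMonoid.exists_character (hS : IsToricMonoid S) {k K : Type*} [Field k] [Field K]
    {φ : AddMonoidAlgebra k S →+* K} (hφ : Function.Injective φ) :
    ∃ χ : Multiplicative M →* Kˣ, ∀ s : S, (χ (.ofAdd s.1) : K) = φ (.single s 1) := by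
  have h0 : ∀ s : S, φ (.single s 1) ≠ 0 := fun s => by
    rw [map_ne_zero_iff _ hφ]
    exact AddMonoidAlgebra.single_ne_zero.mpr one_ne_zero
  obtain ⟨χ, hχ⟩ := hS.exists_extension (fun s => Units.mk0 _ (h0 s)) fun s t => by
    ext
    rw [Units.val_mul, Units.val_mk0, Units.val_mk0, Units.val_mk0, ← map_mul,
      AddMonoidAlgebra.single_mul_single, one_mul]
  exact ⟨χ, fun s => by rw [hχ, Units.val_mk0]⟩

end Extension

/-! ### Reduction of étaleness to logarithmic differentials -/

section FunctionField

variable {k A K : Type u} [Field k] [CommRing A] [IsDomain A] [Algebra k A] [Field K] [Algebra k K]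

lemma isAlgebraic_of_formallyEtale [Algebra A K] [FaithfulSMul A K] [Algebra.FormallyEtale A K]
    [Algebra.EssFiniteType A K] : Algebra.IsAlgebraic A K := by
  let : Algebra (FractionRing A) K := FractionRing.liftAlgebra A K
  have : Algebra.FormallyEtale A (FractionRing A) := .of_isLocalization (nonZeroDivisors A)
  have : Algebra.FormallyEtale (FractionRing A) K := .of_restrictScalars (R := A)
  have : Algebra.EssFiniteType (FractionRing A) K := .of_comp A _ _
  have := Algebra.FormallyUnramified.isSeparable (FractionRing A) K
  exact (IsFractionRing.comap_isAlgebraic_iff (K := FractionRing A)).mpr inferInstance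

/-- Suppose that the function field `K` is algebraic over `A` along one embedding. By comparing
transcendence degrees, `K` is algebraic over `A` along every embedding, hence in characteristic
zero formally étale. -/
lemma formallyEtale_of_isAlgebraic [CharZero k] [Algebra.FiniteType k A] {φ ψ : A →ₐ[k] K}
    (hφ : Function.Injective φ) (hψ : Function.Injective ψ)
    (halg : letI := φ.toRingHom.toAlgebra; Algebra.IsAlgebraic A K) :
    letI := ψ.toRingHom.toAlgebra; Algebra.FormallyEtale A K := by
  have h1 : Algebra.trdeg k A = Algebra.trdeg k K := by
    let := φ.toRingHom.toAlgebra
    have : IsScalarTower k A K := .of_algebraMap_eq fun a => (φ.commutes a).symm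
    have : FaithfulSMul A K := (faithfulSMul_iff_algebraMap_injective A K).mpr hφ
    rw [← trdeg_add_eq k A (A := K), trdeg_eq_zero_iff.mpr halg, add_zero]
  let := ψ.toRingHom.toAlgebra
  have : IsScalarTower k A K := .of_algebraMap_eq fun a => (ψ.commutes a).symm
  have : FaithfulSMul A K := (faithfulSMul_iff_algebraMap_injective A K).mpr hψ
  have h2 := trdeg_add_eq k A (A := K)
  rw [← h1] at h2
  have h3 : Algebra.trdeg A K = 0 := by
    refine Cardinal.eq_of_add_eq_add_left (h2.trans (add_zero _).symm) ?_
    exact trdeg_lt_aleph0_of_finiteType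
  have halgA : Algebra.IsAlgebraic A K := trdeg_eq_zero_iff.mp h3
  let : Algebra (FractionRing A) K := FractionRing.liftAlgebra A K
  have : Algebra.IsAlgebraic (FractionRing A) K :=
    (IsFractionRing.comap_isAlgebraic_iff (K := FractionRing A)).mp halgA
  have : CharZero (FractionRing A) := charZero_of_injective_algebraMap
    (R := k) (algebraMap k (FractionRing A)).injective
  have : Algebra.FormallyEtale A (FractionRing A) := .of_isLocalization (nonZeroDivisors A)
  have : Algebra.FormallyEtale (FractionRing A) K := .of_isSeparable _ _
  exact .comp A (FractionRing A) K

end FunctionField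

section Main

variable {k M ι : Type u} [Field k] [AddCommGroup M] {S : AddSubmonoid M}

lemma IsToricMonoid.dlog_character_eq_sub (hS : IsToricMonoid S) {K : Type*} [Field K] [Algebra k K]
    (χ : Multiplicative M →* Kˣ) (m : M) :
    ∃ p q : S, (p : M) = m + q ∧
      dlog k (χ (.ofAdd m) : K) = dlog k (χ (.ofAdd p.1) : K) - dlog k (χ (.ofAdd q.1) : K) := by
  obtain ⟨p, q, h⟩ := hS.exists_eq_add m
  refine ⟨p, q, h, ?_⟩
  rw [h, ofAdd_add, map_mul, Units.val_mul, dlog_mul k (Units.ne_zero _) (Units.ne_zero _),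
    add_sub_cancel_right]

/-- If `K` is étale over `k[S]`, the logarithmic differentials of the characters span the
differential forms of `K`. -/
lemma D_mem_span_dlog {K : Type*} [Field K] [Algebra k K] [Fintype ι] (b : Module.Basis ι ℤ M)
    {φ : AddMonoidAlgebra k S →ₐ[k] K}
    (hφ : letI := φ.toRingHom.toAlgebra; Algebra.FormallyEtale (AddMonoidAlgebra k S) K)
    (χ : Multiplicative M →* Kˣ) (hχ : ∀ s : S, (χ (.ofAdd s.1) : K) = φ (.single s 1)) (x : K) :
    ∃ c : ι → K, KaehlerDifferential.D k K x = ∑ i, c i • dlog k (χ (.ofAdd (b i)) : K) := by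
  let := φ.toRingHom.toAlgebra
  have : IsScalarTower k (AddMonoidAlgebra k S) K := .of_algebraMap_eq fun a => (φ.commutes a).symm
  have := hφ
  obtain ⟨δ, hδ⟩ := exists_logDerivation (k := k) (B := K) b (S := S)
  refine ⟨fun i => δ i x, derivation_eq_sum_logDerivation b δ hδ _ _ (fun s => ?_) x⟩
  rw [← dlog_character k b χ, hχ]
  refine (smul_dlog k ?_).symm
  change φ _ ≠ 0
  rw [← hχ]
  exact Units.ne_zero _

/-- The reduction of étaleness to differential forms. Here `B` stands for a local ring of `X`, `K`
for the function field, `Λ` for the logarithmic forms on `X` and `P` for the pullback of those on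
the toric variety. -/
theorem formallyEtale_of_free_quotient [CharZero k] [Module.Free ℤ M] [Module.Finite ℤ M]
    (hS : IsToricMonoid S) {B K : Type u} [CommRing B] [IsDomain B] [Algebra k B] [Field K]
    [Algebra k K] [Algebra B K] [IsScalarTower k B K] [IsFractionRing B K]
    (ρ ψ : AddMonoidAlgebra k S →ₐ[k] B)
    (hρ : letI := ρ.toRingHom.toAlgebra; Algebra.FormallyEtale (AddMonoidAlgebra k S) B)
    (hess : letI := ρ.toRingHom.toAlgebra; Algebra.EssFiniteType (AddMonoidAlgebra k S) B)
    (hρi : Function.Injective ρ) (hψi : Function.Injective ψ)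
    (u : S → Bˣ) (hu : ∀ s : S, ρ (.single s 1) = u s * ψ (.single s 1))
    (Λ P : Submodule B Ω[K⁄k])
    (hΛ : ∀ s : S, dlog k (algebraMap B K (ρ (.single s 1))) ∈ Λ)
    (hP : ∀ s : S, dlog k (algebraMap B K (ψ (.single s 1))) ∈ P)
    (hP' : P ≤ Submodule.span B
      (Set.range fun s : S => dlog k (algebraMap B K (ψ (.single s 1)))))
    (hfree : Module.Free B (Λ ⧸ P.submoduleOf Λ)) :
    letI := ψ.toRingHom.toAlgebra; Algebra.FormallyEtale (AddMonoidAlgebra k S) B := by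
  classical
  have hinj : Function.Injective (algebraMap B K) := IsFractionRing.injective B K
  have hψ0 : ∀ s : S, ψ (.single s 1) ≠ 0 := fun s => by
    rw [map_ne_zero_iff _ hψi]
    exact AddMonoidAlgebra.single_ne_zero.mpr one_ne_zero
  have hsingle : ∀ s t : S, (.single (s + t) 1 : AddMonoidAlgebra k S) =
      .single s 1 * .single t 1 := fun s t => by rw [AddMonoidAlgebra.single_mul_single, one_mul]
  let b := Module.Free.chooseBasis ℤ M
  let ιM := Module.Free.ChooseBasisIndex ℤ M
  obtain ⟨U, hU⟩ := hS.exists_extension u fun s t => by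
    ext
    have h1 := hu (s + t)
    rw [hsingle, map_mul, map_mul, hu, hu] at h1
    refine mul_right_cancel₀ (mul_ne_zero (hψ0 s) (hψ0 t)) ?_
    rw [← h1, Units.val_mul]
    ring
  obtain ⟨χψ, hχψ⟩ := hS.exists_character (φ := (algebraMap B K).comp ψ.toRingHom) (hinj.comp hψi)
  replace hχψ : ∀ s : S, (χψ (.ofAdd s.1) : K) = algebraMap B K (ψ (.single s 1)) := hχψ
  let χρ : Multiplicative M →* Kˣ := (Units.map (algebraMap B K).toMonoidHom).comp U * χψ
  have hχρU : ∀ m, (χρ m : K) = algebraMap B K (U m) * χψ m := fun m => rfl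
  have hχρ : ∀ s : S, (χρ (.ofAdd s.1) : K) = algebraMap B K (ρ (.single s 1)) := fun s => by
    rw [hχρU, hχψ, hU, hu, map_mul]
  let ωψ : ιM → Ω[K⁄k] := fun i => dlog k (χψ (.ofAdd (b i)) : K)
  let ωρ : ιM → Ω[K⁄k] := fun i => dlog k (χρ (.ofAdd (b i)) : K)
  have hωψ : ∀ i, ωψ i ∈ P := fun i => by
    obtain ⟨p, q, -, h⟩ := hS.dlog_character_eq_sub (k := k) χψ (b i)
    rw [hχψ, hχψ] at h
    change dlog k _ ∈ P
    rw [h]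
    exact P.sub_mem (hP p) (hP q)
  have hωρ : ∀ i, ωρ i ∈ Λ := fun i => by
    obtain ⟨p, q, -, h⟩ := hS.dlog_character_eq_sub (k := k) χρ (b i)
    rw [hχρ, hχρ] at h
    change dlog k _ ∈ Λ
    rw [h]
    exact Λ.sub_mem (hΛ p) (hΛ q)
  -- `K` is étale over `k[S]` along `ψ`, so the `ωψ` span the rational forms
  have hψet : letI := ((IsScalarTower.toAlgHom k B K).comp ψ).toRingHom.toAlgebra
      Algebra.FormallyEtale (AddMonoidAlgebra k S) K := by
    have : AddMonoid.FG S := (AddMonoid.fg_iff_addSubmonoid_fg S).mpr hS.fg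
    refine formallyEtale_of_isAlgebraic (k := k) (φ := (IsScalarTower.toAlgHom k B K).comp ρ)
      (hinj.comp hρi) (hinj.comp hψi) ?_
    let := ρ.toRingHom.toAlgebra
    let := ((IsScalarTower.toAlgHom k B K).comp ρ).toRingHom.toAlgebra
    have : IsScalarTower (AddMonoidAlgebra k S) B K := .of_algebraMap_eq fun a => rfl
    have := hρ
    have := hess
    have : Algebra.FormallyEtale B K := .of_isLocalization (nonZeroDivisors B)
    have : Algebra.EssFiniteType B K := .of_isLocalization K (nonZeroDivisors B)
    have : Algebra.FormallyEtale (AddMonoidAlgebra k S) K := .comp _ B _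
    have : Algebra.EssFiniteType (AddMonoidAlgebra k S) K := .comp _ B _
    have : FaithfulSMul (AddMonoidAlgebra k S) K :=
      (faithfulSMul_iff_algebraMap_injective _ K).mpr (hinj.comp hρi)
    exact isAlgebraic_of_formallyEtale
  -- hence `Λ / P`, which is free, is torsion at the `ωρ`
  have hmem : ∀ j, ωρ j ∈ P := fun j => by
    obtain ⟨c, hc⟩ := D_mem_span_dlog b hψet χψ hχψ (χρ (.ofAdd (b j)) : K)
    obtain ⟨d, hd⟩ := IsLocalization.exist_integer_multiples (nonZeroDivisors B) Finset.univ
      fun i => (χρ (.ofAdd (b j)) : K)⁻¹ * c i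
    have hdω : (d : B) • ωρ j ∈ P := by
      have : (d : B) • ωρ j = ∑ i, ((d : B) • ((χρ (.ofAdd (b j)) : K)⁻¹ * c i)) • ωψ i := by
        simp only [ωρ, dlog, hc, Finset.smul_sum]
        refine Finset.sum_congr rfl fun i _ => ?_
        rw [smul_smul, smul_assoc]
        rfl
      rw [this]
      refine P.sum_mem fun i _ => ?_
      obtain ⟨e, he⟩ := hd i (Finset.mem_univ i)
      rw [← he, algebraMap_smul]
      exact P.smul_mem e (hωψ i)
    have h0 : (d : B) • (Submodule.Quotient.mk ⟨ωρ j, hωρ j⟩ : Λ ⧸ P.submoduleOf Λ) = 0 := by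
      rw [← Submodule.Quotient.mk_smul, Submodule.Quotient.mk_eq_zero]
      exact hdω
    have h1 := (smul_eq_zero.mp h0).resolve_left (nonZeroDivisors.ne_zero d.2)
    rwa [Submodule.Quotient.mk_eq_zero] at h1
  -- so the forms `dlog ρ(eⱼ)` are `B`-linear combinations of the `dlog ψ(eᵢ)`
  have hspan : P ≤ Submodule.span B (Set.range ωψ) := by
    refine hP'.trans (Submodule.span_le.mpr ?_)
    rintro _ ⟨s, rfl⟩
    change dlog k _ ∈ _
    rw [← hχψ, dlog_character k b χψ]
    exact Submodule.sum_mem _ fun i _ => zsmul_mem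
      (Submodule.subset_span (Set.mem_range_self (f := ωψ) i)) _
  have hQ : ∀ j, ∃ c : ιM → B, ∑ i, c i • ωψ i = ωρ j := fun j =>
    (Submodule.mem_span_range_iff_exists_fun B).mp (hspan (hmem j))
  choose Q hQ using hQ
  let := ρ.toRingHom.toAlgebra
  have : IsScalarTower k (AddMonoidAlgebra k S) B := .of_algebraMap_eq fun a => (ρ.commutes a).symm
  have hρ' := hρ
  obtain ⟨δ, hδ⟩ := exists_logDerivation (k := k) (B := B) b (S := S)
  refine formallyEtale_of_unit_twist b ρ ψ hρ U (fun s => by rw [hU]; exact hu s) δ hδ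
    (Matrix.of fun i j => Q j i) ?_
  -- extend the logarithmic derivations to `K` and evaluate them on the relations `hQ`
  have hδK : ∀ l, ∃ E : Ω[K⁄k] →ₗ[K] K, ∀ x : B, algebraMap B K x ≠ 0 →
      E (dlog k (algebraMap B K x)) = (algebraMap B K x)⁻¹ * algebraMap B K (δ l x) := fun l => by
    have : Algebra.FormallyEtale B K := .of_isLocalization (nonZeroDivisors B)
    obtain ⟨D, hD⟩ := exists_derivation_extension (B := K) ((Algebra.linearMap B K).compDer (δ l))
    refine ⟨D.liftKaehlerDifferential, fun x hx => ?_⟩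
    rw [dlog, map_smul, Derivation.liftKaehlerDifferential_comp_D, hD]
    rfl
  choose E hE using hδK
  have hEρ : ∀ l m, E l (dlog k (χρ (.ofAdd m) : K)) = (b.repr m l : K) := fun l m => by
    have hs : ∀ s : S, E l (dlog k (χρ (.ofAdd s.1) : K)) = (b.repr s.1 l : K) := fun s => by
      have h0 : algebraMap B K (ρ (.single s 1)) ≠ 0 := hχρ s ▸ Units.ne_zero _
      have h1 : δ l (ρ (.single s 1)) = (b.repr s.1 l : B) * ρ (.single s 1) := hδ l s
      rw [hχρ, hE _ _ h0, h1, map_mul, map_intCast]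
      field_simp
    obtain ⟨p, q, hpq, h⟩ := hS.dlog_character_eq_sub (k := k) χρ m
    rw [h, map_sub, hs, hs, hpq, map_add, Finsupp.add_apply]
    push_cast
    ring
  have hEψ : ∀ l i, E l (ωψ i) = algebraMap B K ((if l = i then 1 else 0) -
      ((U (.ofAdd (b i)))⁻¹ : Bˣ) * δ l (U (.ofAdd (b i)) : B)) := fun l i => by
    have hU0 : algebraMap B K (U (.ofAdd (b i))) ≠ 0 :=
      (map_ne_zero_iff _ hinj).mpr (Units.ne_zero _)
    have h1 := hEρ l (b i)
    rw [hχρU, dlog_mul k hU0 (Units.ne_zero _), map_add, hE l _ hU0] at h1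
    have h2 : algebraMap B K ((U (.ofAdd (b i)))⁻¹ : Bˣ) =
        (algebraMap B K (U (.ofAdd (b i))))⁻¹ := by
      refine eq_inv_of_mul_eq_one_left ?_
      rw [← map_mul, Units.inv_mul, map_one]
    have h3 : ((b.repr (b i) l : ℤ) : K) = algebraMap B K (if l = i then 1 else 0) := by
      rw [b.repr_self, Finsupp.single_apply]
      rcases eq_or_ne l i with rfl | h
      · simp
      · simp [h, h.symm]
    rw [map_sub, map_mul, h2, ← h3, ← h1]
    change E l (dlog k _) = _
    ring
  ext l j
  apply hinj
  rw [Matrix.mul_apply, map_sum]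
  have h1 := congrArg (E l) (hQ j)
  rw [map_sum] at h1
  have h2 : E l (ωρ j) = algebraMap B K ((1 : Matrix ιM ιM B) l j) := by
    rw [Matrix.one_apply]
    refine (hEρ l (b j)).trans ?_
    rw [b.repr_self, Finsupp.single_apply]
    rcases eq_or_ne l j with rfl | h
    · simp
    · simp [h, h.symm]
  rw [← h2, ← h1]
  refine Finset.sum_congr rfl fun i _ => ?_
  rw [← algebraMap_smul K, map_smul, hEψ, smul_eq_mul, ← map_mul, mul_comm]
  rfl

end Main

/-! ### Local rings and rational functions -/

section Rational

variable {X Y : Scheme.{u}}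

lemma pullbackRat_germ [IrreducibleSpace X] [IrreducibleSpace Y] (f : X ⟶ Y) [IsDominant f]
    (s : Γ(Y, ⊤)) :
    pullbackRat f (Y.presheaf.germ ⊤ (genericPoint Y) (Opens.mem_top _) s) =
      X.presheaf.germ ⊤ (genericPoint X) (Opens.mem_top _) (f.appTop s) := by
  have h : Y.presheaf.germ ⊤ (genericPoint Y) (Opens.mem_top _) ≫
      Y.presheaf.stalkSpecializes (map_genericPoint_specializes f) ≫ f.stalkMap (genericPoint X) =
      f.appTop ≫ X.presheaf.germ ⊤ (genericPoint X) (Opens.mem_top _) := by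
    rw [TopCat.Presheaf.germ_stalkSpecializes_assoc, Scheme.Hom.germ_stalkMap]
    rfl
  exact DFunLike.congr_fun (congrArg CommRingCat.Hom.hom h) s

lemma pullbackRat_algebraMap_stalk [IrreducibleSpace X] [IrreducibleSpace Y] (f : X ⟶ Y)
    [IsDominant f] (x : X) (a : Y.presheaf.stalk (f x)) :
    pullbackRat f (algebraMap _ Y.functionField a) =
      algebraMap _ X.functionField (f.stalkMap x a) := by
  have h : Y.presheaf.stalkSpecializes ((genericPoint_spec Y).specializes trivial) ≫
      Y.presheaf.stalkSpecializes (map_genericPoint_specializes f) ≫ f.stalkMap (genericPoint X) =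
      f.stalkMap x ≫ X.presheaf.stalkSpecializes ((genericPoint_spec X).specializes trivial) := by
    rw [TopCat.Presheaf.stalkSpecializes_comp_assoc, Scheme.Hom.stalkSpecializes_stalkMap]
  exact DFunLike.congr_fun (congrArg CommRingCat.Hom.hom h) a

instance (k : Type u) [Field k] [IrreducibleSpace X] [X.Over (Spec (.of k))] (x : X) :
    IsScalarTower k (X.presheaf.stalk x) X.functionField := by
  refine .of_algebraMap_eq fun a => ?_
  rw [algebraMap_stalk_apply, algebraMap_stalk_apply]
  have : Nonempty (⊤ : X.Opens) := ⟨⟨x, trivial⟩⟩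
  rw [Scheme.algebraMap_germ_eq_germToFunctionField]

end Rational

section StalkHom

variable {k : Type u} [Field k] {M : Type u} [AddCommGroup M] {S : AddSubmonoid M}
variable {X : Scheme.{u}} [X.Over (Spec (.of k))]

/-- The homomorphism `k[S] → 𝒪_{X,x}` given by a `k`-morphism from `X` to `Spec k[S]`. -/
noncomputable def stalkHom (f : X ⟶ toricVariety k S) [f.IsOver (Spec (.of k))] (x : X) :
    AddMonoidAlgebra k S →ₐ[k] X.presheaf.stalk x where
  __ := ((Scheme.ΓSpecIso (.of (AddMonoidAlgebra k S))).inv ≫ f.appTop ≫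
    X.presheaf.germ ⊤ x (Opens.mem_top _)).hom
  commutes' a := by
    have h : CommRingCat.ofHom (algebraMap k (AddMonoidAlgebra k S)) ≫
        (Scheme.ΓSpecIso (.of (AddMonoidAlgebra k S))).inv ≫ f.appTop ≫
        X.presheaf.germ ⊤ x (Opens.mem_top _) =
        (Scheme.ΓSpecIso (.of k)).inv ≫ (X ↘ Spec (.of k)).appTop ≫
        X.presheaf.germ ⊤ x (Opens.mem_top _) := by
      rw [← comp_over f (Spec (.of k)), Scheme.ΓSpecIso_inv_naturality_assoc]
      simp only [Category.assoc, Scheme.Hom.comp_appTop]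
      rfl
    exact DFunLike.congr_fun (congrArg CommRingCat.Hom.hom h) a

lemma stalkHom_apply (f : X ⟶ toricVariety k S) [f.IsOver (Spec (.of k))] (x : X)
    (a : AddMonoidAlgebra k S) :
    stalkHom f x a = X.presheaf.germ ⊤ x (Opens.mem_top _)
      (f.appTop ((Scheme.ΓSpecIso (.of (AddMonoidAlgebra k S))).inv a)) := rfl

variable [Module.Free ℤ M] [IsIntegral X]

lemma algebraMap_stalkHom (f : X ⟶ toricVariety k S) [f.IsOver (Spec (.of k))] [IsDominant f]
    (x : X) (a : AddMonoidAlgebra k S) :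
    algebraMap _ X.functionField (stalkHom f x a) =
      pullbackRat f ((toricVariety k S).presheaf.germ ⊤ (genericPoint _) (Opens.mem_top _)
        ((Scheme.ΓSpecIso (.of (AddMonoidAlgebra k S))).inv a)) := by
  have : Nonempty (⊤ : X.Opens) := ⟨⟨x, trivial⟩⟩
  rw [stalkHom_apply, pullbackRat_germ, Scheme.algebraMap_germ_eq_germToFunctionField]

lemma stalkHom_injective (f : X ⟶ toricVariety k S) [f.IsOver (Spec (.of k))] [IsDominant f]
    (x : X) : Function.Injective (stalkHom f x) := by
  have h : Function.Injective fun a => algebraMap _ X.functionField (stalkHom f x a) := by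
    simp_rw [algebraMap_stalkHom]
    have h1 : Function.Injective ((toricVariety k S).presheaf.germ ⊤ (genericPoint _)
      (Opens.mem_top _)) := germ_injective_of_isIntegral _ _ _
    let e := (Scheme.ΓSpecIso (.of (AddMonoidAlgebra k S))).symm.commRingCatIsoToRingEquiv
    exact (pullbackRat f).injective.comp (h1.comp e.injective)
  exact .of_comp h

end StalkHom

/-! ### Étaleness at a point and the local ring -/

section Etale

variable {k : Type u} [Field k] {M : Type u} [AddCommGroup M] {S : AddSubmonoid M}
variable {X : Scheme.{u}}

lemma le_preimage_top {Y : Scheme.{u}} (f : X ⟶ Y) (W : X.Opens) : W ≤ f ⁻¹ᵁ ⊤ := fun _ _ => trivial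

/-- The homomorphism `k[S] → Γ(X, W)` given by a morphism from `X` to `Spec k[S]`. -/
noncomputable def sectionHom (f : X ⟶ toricVariety k S) (W : X.Opens) :
    AddMonoidAlgebra k S →+* Γ(X, W) :=
  ((Scheme.ΓSpecIso (.of (AddMonoidAlgebra k S))).inv ≫ f.appLE ⊤ W (le_preimage_top f W)).hom

lemma res_sectionHom (f : X ⟶ toricVariety k S) {V W : X.Opens} (h : W ≤ V)
    (a : AddMonoidAlgebra k S) :
    X.presheaf.map (homOfLE h).op (sectionHom f V a) = sectionHom f W a := by
  have : ((Scheme.ΓSpecIso (.of (AddMonoidAlgebra k S))).inv ≫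
      f.appLE ⊤ V (le_preimage_top f V)) ≫
      X.presheaf.map (homOfLE h).op =
      (Scheme.ΓSpecIso (.of (AddMonoidAlgebra k S))).inv ≫ f.appLE ⊤ W (le_preimage_top f W) := by
    rw [Category.assoc, Scheme.Hom.appLE_map]
  exact DFunLike.congr_fun (congrArg CommRingCat.Hom.hom this) a

lemma sectionHom_etale (f : X ⟶ toricVariety k S) [Etale f] {W : X.Opens}
    (hW : IsAffineOpen W) : (sectionHom f W).Etale := by
  have h := f.etale_appLE (isAffineOpen_top _) hW (le_preimage_top f W)
  exact RingHom.Etale.respectsIso.2 _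
    (Scheme.ΓSpecIso (.of (AddMonoidAlgebra k S))).symm.commRingCatIsoToRingEquiv h

lemma etale_of_sectionHom_etale (f : X ⟶ toricVariety k S) {W : X.Opens}
    (hW : IsAffineOpen W) (h : (sectionHom f W).Etale) : Etale (W.ι ≫ f) := by
  have : IsAffine W := hW
  have h1 : (f.appLE ⊤ W (le_preimage_top f W)).hom.Etale := by
    have h2 := RingHom.Etale.respectsIso.2 _
      (Scheme.ΓSpecIso (.of (AddMonoidAlgebra k S))).commRingCatIsoToRingEquiv h
    have h3 : (Scheme.ΓSpecIso (.of (AddMonoidAlgebra k S))).hom ≫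
      (Scheme.ΓSpecIso (.of (AddMonoidAlgebra k S))).inv ≫ f.appLE ⊤ W (le_preimage_top f W) =
      f.appLE ⊤ W (le_preimage_top f W) := Iso.hom_inv_id_assoc _ _
    rw [← h3]
    exact h2
  have h4 : (W.ι ≫ f).appTop = f.appLE ⊤ W (le_preimage_top f W) ≫ W.topIso.inv := by
    rw [Iso.eq_comp_inv, Scheme.Hom.comp_appTop, Scheme.Opens.ι_appTop, Scheme.Opens.topIso_hom]
    refine (Category.assoc f.appTop _ _).trans (congrArg (f.appTop ≫ ·) ?_)
    exact (X.presheaf.map_comp _ _).symm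
  rw [HasRingHomProperty.iff_of_isAffine (P := @Etale), h4]
  exact RingHom.Etale.respectsIso.1 _ W.topIso.symm.commRingCatIsoToRingEquiv h1

lemma exists_isAffineOpen_mem (x : X) : ∃ W : X.Opens, IsAffineOpen W ∧ x ∈ W := by
  obtain ⟨_, ⟨W, hW, rfl⟩, hx, -⟩ :=
    X.isBasis_affineOpens.exists_subset_of_mem_open (Set.mem_univ x) isOpen_univ
  exact ⟨W, hW, hx⟩

variable [X.Over (Spec (.of k))]

lemma germ_sectionHom (f : X ⟶ toricVariety k S) [f.IsOver (Spec (.of k))] {W : X.Opens} {x : X}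
    (hx : x ∈ W) (a : AddMonoidAlgebra k S) :
    X.presheaf.germ W x hx (sectionHom f W a) = stalkHom f x a := by
  have h : ((Scheme.ΓSpecIso (.of (AddMonoidAlgebra k S))).inv ≫
      f.appLE ⊤ W (le_preimage_top f W)) ≫
      X.presheaf.germ W x hx = (Scheme.ΓSpecIso (.of (AddMonoidAlgebra k S))).inv ≫ f.appTop ≫
      X.presheaf.germ ⊤ x (Opens.mem_top _) := by
    have h1 : f.appLE ⊤ W (le_preimage_top f W) =
      f.appTop ≫ X.presheaf.map (homOfLE le_top).op := rfl
    rw [h1, Category.assoc, Category.assoc, TopCat.Presheaf.germ_res]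
  exact DFunLike.congr_fun (congrArg CommRingCat.Hom.hom h) a

lemma stalkHom_formallyEtale_of_etale (f : X ⟶ toricVariety k S) [f.IsOver (Spec (.of k))]
    [Etale f] (x : X) :
    letI := (stalkHom f x).toRingHom.toAlgebra
    Algebra.FormallyEtale (AddMonoidAlgebra k S) (X.presheaf.stalk x) ∧
      Algebra.EssFiniteType (AddMonoidAlgebra k S) (X.presheaf.stalk x) := by
  obtain ⟨W, hW, hx⟩ := exists_isAffineOpen_mem x
  let := (stalkHom f x).toRingHom.toAlgebra
  let := (sectionHom f W).toAlgebra
  let := X.presheaf.algebra_section_stalk ⟨x, hx⟩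
  have : IsScalarTower (AddMonoidAlgebra k S) Γ(X, W) (X.presheaf.stalk x) :=
    .of_algebraMap_eq fun a => (germ_sectionHom f hx a).symm
  have : Algebra.Etale (AddMonoidAlgebra k S) Γ(X, W) := sectionHom_etale f hW
  have := hW.isLocalization_stalk ⟨x, hx⟩
  have : Algebra.FormallyEtale Γ(X, W) (X.presheaf.stalk x) :=
    .of_isLocalization (hW.primeIdealOf ⟨x, hx⟩).asIdeal.primeCompl
  have : Algebra.EssFiniteType Γ(X, W) (X.presheaf.stalk x) :=
    .of_isLocalization _ (hW.primeIdealOf ⟨x, hx⟩).asIdeal.primeCompl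
  exact ⟨.comp _ Γ(X, W) _, .comp _ Γ(X, W) _⟩

/-- A morphism of finite presentation is étale near `x` if its local homomorphism at `x` is formally
étale, since the étale locus is open. -/
lemma exists_etale_of_stalkHom_formallyEtale (f : X ⟶ toricVariety k S)
    [f.IsOver (Spec (.of k))] [LocallyOfFinitePresentation f] (x : X)
    (h : letI := (stalkHom f x).toRingHom.toAlgebra
      Algebra.FormallyEtale (AddMonoidAlgebra k S) (X.presheaf.stalk x)) :
    ∃ W : X.Opens, x ∈ W ∧ Etale (W.ι ≫ f) := by
  obtain ⟨W, hW, hx⟩ := exists_isAffineOpen_mem x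
  let := (stalkHom f x).toRingHom.toAlgebra
  let := (sectionHom f W).toAlgebra
  let := X.presheaf.algebra_section_stalk ⟨x, hx⟩
  have : IsScalarTower (AddMonoidAlgebra k S) Γ(X, W) (X.presheaf.stalk x) :=
    .of_algebraMap_eq fun a => (germ_sectionHom f hx a).symm
  have : Algebra.FinitePresentation (AddMonoidAlgebra k S) Γ(X, W) := by
    have h := f.finitePresentation_appLE (isAffineOpen_top _) hW (le_preimage_top f W)
    exact RingHom.finitePresentation_respectsIso.2 _
      (Scheme.ΓSpecIso (.of (AddMonoidAlgebra k S))).symm.commRingCatIsoToRingEquiv h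
  have := hW.isLocalization_stalk ⟨x, hx⟩
  let P := hW.primeIdealOf ⟨x, hx⟩
  have : Algebra.IsEtaleAt (AddMonoidAlgebra k S) P.asIdeal := by
    have := h
    exact Algebra.FormallyEtale.of_equiv ((IsLocalization.algEquiv P.asIdeal.primeCompl
      (X.presheaf.stalk x) (Localization.AtPrime P.asIdeal)).restrictScalars
        (AddMonoidAlgebra k S))
  obtain ⟨r, hr, het⟩ := Algebra.exists_etale_of_isEtaleAt (R := AddMonoidAlgebra k S) P.asIdeal
  refine ⟨X.basicOpen r, ?_, etale_of_sectionHom_etale f (hW.basicOpen r) ?_⟩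
  · change P ∈ PrimeSpectrum.basicOpen r at hr
    rw [← hW.fromSpec_preimage_basicOpen] at hr
    have h1 : hW.fromSpec P ∈ X.basicOpen r := hr
    rwa [hW.fromSpec_primeIdealOf] at h1
  · have := hW.isLocalization_basicOpen r
    let := (sectionHom f (X.basicOpen r)).toAlgebra
    have : IsScalarTower (AddMonoidAlgebra k S) Γ(X, W) Γ(X, X.basicOpen r) :=
      .of_algebraMap_eq fun a => (res_sectionHom f (X.basicOpen_le r) a).symm
    exact Algebra.Etale.of_equiv ((IsLocalization.algEquiv (.powers r) (Localization.Away r)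
      Γ(X, X.basicOpen r)).restrictScalars (AddMonoidAlgebra k S))

lemma locallyOfFinitePresentation_toricVariety (hS : S.FG) (f : X ⟶ toricVariety k S)
    [f.IsOver (Spec (.of k))] [LocallyOfFiniteType (X ↘ Spec (.of k))] :
    LocallyOfFinitePresentation f := by
  have : AddMonoid.FG S := (AddMonoid.fg_iff_addSubmonoid_fg S).mpr hS
  have : IsNoetherianRing (AddMonoidAlgebra k S) :=
    Algebra.FiniteType.isNoetherianRing k (AddMonoidAlgebra k S)
  have : LocallyOfFiniteType (f ≫ (toricVariety k S ↘ Spec (.of k))) := by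
    rw [comp_over]; infer_instance
  have : LocallyOfFiniteType f := locallyOfFiniteType_of_comp f (toricVariety k S ↘ Spec (.of k))
  infer_instance

end Etale

/-! ### Coordinates of a differential form in terms of a basis of characters -/

section LogFunctional

variable {k M ι K : Type*} [Field k] [AddCommGroup M] {S : AddSubmonoid M} [Field K]
  [Algebra k K] [Algebra (AddMonoidAlgebra k S) K] [IsScalarTower k (AddMonoidAlgebra k S) K]

/-- The linear functionals `ℓᵢ` on differential forms that are dual to the logarithmic differentials
of a basis of the lattice: `ℓᵢ (dlog s) = sᵢ`. -/
lemma exists_logFunctional [FaithfulSMul (AddMonoidAlgebra k S) K]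
    [Algebra.FormallyEtale (AddMonoidAlgebra k S) K] (b : Module.Basis ι ℤ M) :
    ∃ ℓ : ι → Ω[K⁄k] →ₗ[K] K, ∀ i (s : S),
      ℓ i (dlog k (algebraMap (AddMonoidAlgebra k S) K (.single s 1))) = (b.repr s.1 i : K) := by
  obtain ⟨δ, hδ⟩ := exists_logDerivation (k := k) (B := K) b (S := S)
  refine ⟨fun i => (δ i).liftKaehlerDifferential, fun i s => ?_⟩
  have h0 : algebraMap (AddMonoidAlgebra k S) K (.single s 1) ≠ 0 := by
    rw [map_ne_zero_iff _ (FaithfulSMul.algebraMap_injective _ K)]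
    exact AddMonoidAlgebra.single_ne_zero.mpr one_ne_zero
  rw [dlog, map_smul, Derivation.liftKaehlerDifferential_comp_D, hδ, smul_eq_mul]
  field_simp

end LogFunctional

section Coordinates

variable {k M ι K : Type*} [Field k] [AddCommGroup M] {S : AddSubmonoid M} [Field K]
  [Algebra k K] [Algebra (AddMonoidAlgebra k S) K]
  [FaithfulSMul (AddMonoidAlgebra k S) K]
  {b : Module.Basis ι ℤ M} {ℓ : ι → Ω[K⁄k] →ₗ[K] K}
  (hℓ : ∀ i (s : S),
    ℓ i (dlog k (algebraMap (AddMonoidAlgebra k S) K (.single s 1))) = (b.repr s.1 i : K))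
include hℓ

lemma logFunctional_D_monomial (i : ι) (s : S) :
    ℓ i (KaehlerDifferential.D k K (algebraMap (AddMonoidAlgebra k S) K (.single s 1))) =
      (b.repr s.1 i : K) * algebraMap (AddMonoidAlgebra k S) K (.single s 1) := by
  have h0 : algebraMap (AddMonoidAlgebra k S) K (.single s 1) ≠ 0 := by
    rw [map_ne_zero_iff _ (FaithfulSMul.algebraMap_injective _ K)]
    exact AddMonoidAlgebra.single_ne_zero.mpr one_ne_zero
  rw [← smul_dlog k h0, map_smul, hℓ, smul_eq_mul, mul_comm]

/-- The coordinates of the differential of a function in `O` belong to `O`, since the logarithmic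
derivations preserve each ring that is étale over `k[S]`. -/
lemma exists_logFunctional_D_eq {O : Type*} [CommRing O] [Algebra k O]
    [Algebra (AddMonoidAlgebra k S) O] [Algebra O K] [IsScalarTower k (AddMonoidAlgebra k S) O]
    [IsScalarTower k O K] [IsScalarTower (AddMonoidAlgebra k S) O K]
    [Algebra.FormallyEtale (AddMonoidAlgebra k S) O] (i : ι) (x : O) :
    ∃ y : O, ℓ i (KaehlerDifferential.D k K (algebraMap O K x)) = algebraMap O K y := by
  obtain ⟨δ, hδ⟩ := exists_logDerivation (k := k) (B := O) b (S := S)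
  refine ⟨δ i x, ?_⟩
  let D₁ : Derivation k O K := ((ℓ i).compDer (KaehlerDifferential.D k K)).compAlgebraMap O
  let D₂ : Derivation k O K := (Algebra.linearMap O K).compDer (δ i)
  have h : D₁ = D₂ := by
    refine derivation_ext_monomials (S := S) fun s => ?_
    change ℓ i (KaehlerDifferential.D k K (algebraMap O K (algebraMap _ O _))) =
      algebraMap O K (δ i (algebraMap _ O _))
    rw [hδ, ← IsScalarTower.algebraMap_apply, logFunctional_D_monomial hℓ, map_mul, map_intCast,
      ← IsScalarTower.algebraMap_apply]
  exact DFunLike.congr_fun h x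

variable [IsScalarTower k (AddMonoidAlgebra k S) K]

/-- The `ℓᵢ` are the coordinates with respect to the logarithmic differentials of the basis. -/
lemma eq_sum_logFunctional [Fintype ι] [Algebra.FormallyEtale (AddMonoidAlgebra k S) K]
    (χ : Multiplicative M →* Kˣ)
    (hχ : ∀ s : S, (χ (.ofAdd s.1) : K) = algebraMap (AddMonoidAlgebra k S) K (.single s 1))
    (ω : Ω[K⁄k]) : ω = ∑ i, ℓ i ω • dlog k (χ (.ofAdd (b i)) : K) := by
  let L : Ω[K⁄k] →ₗ[K] Ω[K⁄k] :=
    ∑ i, (LinearMap.toSpanSingleton K _ (dlog k (χ (.ofAdd (b i)) : K))) ∘ₗ ℓ i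
  have hL : ∀ ω, L ω = ∑ i, ℓ i ω • dlog k (χ (.ofAdd (b i)) : K) := fun ω => by
    simp [L]
  have h : KaehlerDifferential.D k K = L.compDer (KaehlerDifferential.D k K) := by
    refine derivation_ext_monomials (S := S) fun s => ?_
    change _ = L (KaehlerDifferential.D k K _)
    rw [hL]
    simp_rw [logFunctional_D_monomial hℓ]
    rw [← hχ, ← smul_dlog k (Units.ne_zero _), dlog_character k b χ, Finset.smul_sum]
    refine Finset.sum_congr rfl fun i _ => ?_
    rw [← Int.cast_smul_eq_zsmul K, smul_smul, mul_comm]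
  rw [← hL]
  have h2 : L = LinearMap.id := by
    ext x
    exact (DFunLike.congr_fun h x).symm
  rw [h2]
  rfl

end Coordinates

/-! ### Logarithmic forms on the toric variety -/

section ToricStalk

variable {k : Type u} [Field k] {M : Type u} [AddCommGroup M] {S : AddSubmonoid M}

/-- The `k[S]`-algebra structure on the local rings of `Spec k[S]`, in particular on the function
field. -/
noncomputable instance toricStalkAlgebra (p : toricVariety k S) :
    Algebra (AddMonoidAlgebra k S) ((toricVariety k S).presheaf.stalk p) :=
  (stalkHom (𝟙 _) p).toAlgebra

lemma algebraMap_toricStalk (p : toricVariety k S) (a : AddMonoidAlgebra k S) :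
    algebraMap _ ((toricVariety k S).presheaf.stalk p) a =
      (toricVariety k S).presheaf.germ ⊤ p (Opens.mem_top _)
        ((Scheme.ΓSpecIso (.of (AddMonoidAlgebra k S))).inv a) := by
  change stalkHom (𝟙 _) p a = _
  rw [stalkHom_apply, Scheme.Hom.id_appTop]
  rfl

instance (p : toricVariety k S) :
    IsScalarTower k (AddMonoidAlgebra k S) ((toricVariety k S).presheaf.stalk p) :=
  .of_algebraMap_eq fun a => ((stalkHom (𝟙 (toricVariety k S)) p).commutes a).symm

lemma algebraMap_toricStalk_eq_toStalk (p : toricVariety k S) (a : AddMonoidAlgebra k S) :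
    algebraMap _ ((toricVariety k S).presheaf.stalk p) a =
      StructureSheaf.toStalk (AddMonoidAlgebra k S) p a := by
  rw [algebraMap_toricStalk]
  rfl

/-- The prime ideal of `k[S]` corresponding to a point of the toric variety. -/
def toricPrime (p : toricVariety k S) : Ideal (AddMonoidAlgebra k S) :=
  PrimeSpectrum.asIdeal (R := AddMonoidAlgebra k S) p

instance (p : toricVariety k S) : (toricPrime p).IsPrime :=
  PrimeSpectrum.isPrime (R := AddMonoidAlgebra k S) p

instance (p : toricVariety k S) :
    IsLocalization.AtPrime ((toricVariety k S).presheaf.stalk p) (toricPrime p) := by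
  have h := StructureSheaf.IsLocalization.to_stalk (AddMonoidAlgebra k S) p
  have e : toricStalkAlgebra p = StructureSheaf.stalkAlgebra (AddMonoidAlgebra k S) p :=
    Algebra.algebra_ext _ _ fun a => algebraMap_toricStalk_eq_toStalk p a
  rw [e]
  exact h

instance (p : toricVariety k S) :
    Algebra.FormallyEtale (AddMonoidAlgebra k S) ((toricVariety k S).presheaf.stalk p) :=
  .of_isLocalization (toricPrime p).primeCompl

lemma mem_bigTorus_iff (hS : IsToricMonoid S) (p : toricVariety k S) :
    p ∈ bigTorus k S ↔ ∀ s : S, (.single s 1 : AddMonoidAlgebra k S) ∉ toricPrime p := by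
  let := (AddMonoidAlgebra.mapDomainRingHom k S.subtype).toAlgebra
  have := isLocalization_monomials (k := k) S.subtype S.subtype_injective hS.exists_eq_add
  have h := PrimeSpectrum.localization_comap_range (AddMonoidAlgebra k M)
    (MonoidHom.mrange (AddMonoidAlgebra.of k S))
  change p ∈ Set.range (PrimeSpectrum.comap (algebraMap (AddMonoidAlgebra k S)
    (AddMonoidAlgebra k M))) ↔ _
  rw [h]
  change Disjoint _ (toricPrime p : Set (AddMonoidAlgebra k S)) ↔ _
  rw [Set.disjoint_left]
  constructor
  · exact fun h s hs => h ⟨.ofAdd s, rfl⟩ hs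
  · rintro h _ ⟨s, rfl⟩
    exact h s.toAdd

variable [Module.Free ℤ M]

instance (p : toricVariety k S) : IsScalarTower (AddMonoidAlgebra k S)
    ((toricVariety k S).presheaf.stalk p) (toricVariety k S).functionField := by
  refine .of_algebraMap_eq fun a => ?_
  have : Nonempty (⊤ : (toricVariety k S).Opens) := ⟨⟨p, trivial⟩⟩
  rw [algebraMap_toricStalk, algebraMap_toricStalk, Scheme.algebraMap_germ_eq_germToFunctionField]

instance : IsFractionRing (AddMonoidAlgebra k S) (toricVariety k S).functionField := by
  have h := functionField_isFractionRing_of_affine (.of (AddMonoidAlgebra k S))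
  have e : toricStalkAlgebra (genericPoint _) =
      (inferInstance : Algebra (CommRingCat.of (AddMonoidAlgebra k S))
        (toricVariety k S).functionField) :=
    Algebra.algebra_ext _ _ fun a => algebraMap_toricStalk_eq_toStalk _ a
  rw [e]
  exact h

lemma monomialRat_eq (s : S) :
    monomialRat (k := k) s = algebraMap (AddMonoidAlgebra k S) _ (.single s 1) :=
  (algebraMap_toricStalk _ _).symm

end ToricStalk

section ToricForms

open IsLocalRing

variable {k : Type u} [Field k] {M : Type u} [AddCommGroup M]
  {S : AddSubmonoid M}

lemma fromSpecStalk_mem_bigTorus_iff (hS : IsToricMonoid S) {p : toricVariety k S}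
    (q : Spec ((toricVariety k S).presheaf.stalk p)) :
    (toricVariety k S).fromSpecStalk p q ∈ bigTorus k S ↔
      ∀ s : S, algebraMap (AddMonoidAlgebra k S) _ (.single s 1) ∉
        PrimeSpectrum.asIdeal (R := (toricVariety k S).presheaf.stalk p) q := by
  rw [mem_bigTorus_iff hS, Spec.fromSpecStalk_eq]
  refine forall_congr' fun s => not_congr ?_
  rw [algebraMap_toricStalk]
  rfl

variable [Module.Free ℤ M]

/-- At a point outside of the torus whose local ring is a discrete valuation ring, the reduced
boundary is the point itself. -/
lemma boundaryIdeal_eq_maximalIdeal (hS : IsToricMonoid S) (p : toricVariety k S)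
    [IsPrincipalIdealRing ((toricVariety k S).presheaf.stalk p)] (hp : p ∉ bigTorus k S) :
    boundaryIdeal (bigTorus k S) p = maximalIdeal ((toricVariety k S).presheaf.stalk p) := by
  have h : (toricVariety k S).fromSpecStalk p ⁻¹' (bigTorus k S)ᶜ =
      {closedPoint ((toricVariety k S).presheaf.stalk p)} := by
    ext q
    constructor
    · intro hq
      have hq0 : PrimeSpectrum.asIdeal (R := (toricVariety k S).presheaf.stalk p) q ≠ ⊥ := by
        intro h
        refine hq ((fromSpecStalk_mem_bigTorus_iff hS q).mpr fun s => ?_)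
        rw [h, Ideal.mem_bot, map_eq_zero_iff _
          (IsLocalization.injective _ (toricPrime p).primeCompl_le_nonZeroDivisors)]
        exact AddMonoidAlgebra.single_ne_zero.mpr one_ne_zero
      have hprime := PrimeSpectrum.isPrime (R := (toricVariety k S).presheaf.stalk p) q
      exact PrimeSpectrum.ext (eq_maximalIdeal (IsPrime.to_maximal_ideal hq0))
    · rintro rfl
      change _ ∉ _
      rwa [Scheme.fromSpecStalk_closedPoint]
  exact (congrArg PrimeSpectrum.vanishingIdeal h).trans (PrimeSpectrum.vanishingIdeal_singleton _)

lemma mem_niceLocus_of_isPrincipalIdealRing (hS : IsToricMonoid S) (p : toricVariety k S)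
    [IsPrincipalIdealRing ((toricVariety k S).presheaf.stalk p)] :
    p ∈ niceLocus (bigTorus k S) := by
  refine ⟨inferInstance, or_iff_not_imp_left.mpr fun hp => ?_⟩
  rw [boundaryIdeal_eq_maximalIdeal hS p hp]
  let := Ideal.Quotient.field (maximalIdeal ((toricVariety k S).presheaf.stalk p))
  infer_instance

variable {ι : Type*} {b : Module.Basis ι ℤ M}
  {ℓ : ι → RatForms k (toricVariety k S) →ₗ[(toricVariety k S).functionField]
    (toricVariety k S).functionField}

/-- At a point of the toric variety whose local ring is a discrete valuation ring or a field, the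
coordinates of a logarithmic form are regular. -/
lemma exists_logFunctional_eq_of_mem_logFormsAt (hS : IsToricMonoid S)
    (hℓ : ∀ i (s : S), ℓ i (dlog k (algebraMap (AddMonoidAlgebra k S) _ (.single s 1))) =
      (b.repr s.1 i : (toricVariety k S).functionField))
    (p : toricVariety k S) [IsPrincipalIdealRing ((toricVariety k S).presheaf.stalk p)] (i : ι)
    {ω : RatForms k (toricVariety k S)} (hω : ω ∈ logFormsAt k (bigTorus k S) p) :
    ∃ y : (toricVariety k S).presheaf.stalk p, ℓ i ω = algebraMap _ _ y := by
  induction hω using Submodule.span_induction with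
  | zero => exact ⟨0, by simp⟩
  | add ω ω' _ _ h h' =>
    obtain ⟨y, hy⟩ := h
    obtain ⟨y', hy'⟩ := h'
    exact ⟨y + y', by rw [map_add, map_add, hy, hy']⟩
  | smul a ω _ h =>
    obtain ⟨y, hy⟩ := h
    refine ⟨a * y, ?_⟩
    rw [← algebraMap_smul (toricVariety k S).functionField a ω, map_smul, hy, map_mul, smul_eq_mul]
  | mem ω h =>
    obtain ⟨a, rfl⟩ | ⟨g, hg, rfl⟩ := h
    · exact exists_logFunctional_D_eq hℓ i a
    · obtain ⟨y, hy⟩ := exists_logFunctional_D_eq hℓ i g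
      by_cases hp : p ∈ bigTorus k S
      · -- `g` is a unit
        obtain ⟨W, hpW, s, rfl, hs⟩ := hg
        obtain ⟨w, hw⟩ := (Scheme.mem_basicOpen _ _ _ hpW).mp (hs p hpW hp)
        refine ⟨(w⁻¹ : Units _) * y, ?_⟩
        rw [map_smul, hy, map_mul, smul_eq_mul, ← hw, map_units_inv]
      · rcases eq_or_ne g 0 with rfl | hg0
        · -- `dg / g` is zero by convention
          exact ⟨0, by simp⟩
        · -- `g` is a unit times a monomial
          rw [mem_bigTorus_iff hS] at hp
          push Not at hp
          obtain ⟨w, s, rfl⟩ := exists_unit_mul_monomial (toricPrime p) _ hp g hg0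
          obtain ⟨z, hz⟩ := exists_logFunctional_D_eq hℓ i
            (w : (toricVariety k S).presheaf.stalk p)
          refine ⟨(w⁻¹ : Units _) * z + (b.repr s.1 i : (toricVariety k S).presheaf.stalk p), ?_⟩
          change ℓ i (dlog k _) = _
          have hχ0 : algebraMap (AddMonoidAlgebra k S) (toricVariety k S).functionField
              (.single s 1) ≠ 0 := by
            rw [map_ne_zero_iff _ (IsFractionRing.injective _ _)]
            exact AddMonoidAlgebra.single_ne_zero.mpr one_ne_zero
          have hw0 : algebraMap _ (toricVariety k S).functionField
              (w : (toricVariety k S).presheaf.stalk p) ≠ 0 := by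
            rw [map_ne_zero_iff _ (IsFractionRing.injective _ _)]
            exact w.ne_zero
          rw [map_mul, ← IsScalarTower.algebraMap_apply, dlog_mul k hw0 hχ0, map_add, hℓ, dlog,
            map_smul, hz, map_add, map_mul, map_intCast, smul_eq_mul, map_units_inv]

/-- The sheaf of logarithmic forms on a toric variety is generated by the logarithmic differentials
of the monomials. -/
theorem logStalk_bigTorus_le [Module.Finite ℤ M] (hS : IsToricMonoid S) (v : toricVariety k S) :
    logStalk k (bigTorus k S) v ≤ Submodule.span _ (Set.range fun s : S =>
      dlog k (algebraMap (AddMonoidAlgebra k S) (toricVariety k S).functionField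
        (.single s 1))) := by
  rintro ω ⟨W, hvW, hω⟩
  let b := Module.Free.chooseBasis ℤ M
  have : Algebra.FormallyEtale (AddMonoidAlgebra k S) (toricVariety k S).functionField :=
    .of_isLocalization (nonZeroDivisors (AddMonoidAlgebra k S))
  obtain ⟨ℓ, hℓ⟩ := exists_logFunctional (k := k) (K := (toricVariety k S).functionField) b (S := S)
  have : AddMonoid.FG S := (AddMonoid.fg_iff_addSubmonoid_fg S).mpr hS.fg
  have : IsNoetherianRing (AddMonoidAlgebra k S) :=
    Algebra.FiniteType.isNoetherianRing k (AddMonoidAlgebra k S)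
  have : IsIntegrallyClosed (AddMonoidAlgebra k S) := hS.isIntegrallyClosed
  -- the coordinates of `ω` are regular at `v`
  have hreg : ∀ i, ∃ y : (toricVariety k S).presheaf.stalk v,
      ℓ i ω = algebraMap _ _ y := fun i => by
    by_contra hcon
    obtain ⟨p, hp, hpv, hfp, hpid⟩ := exists_isPrincipalIdealRing_of_not_regular
      (toricPrime v) (ℓ i ω) fun a c hc h => by
        refine hcon ⟨IsLocalization.mk' _ a (⟨c, hc⟩ : (toricPrime v).primeCompl), ?_⟩
        have hc0 : algebraMap (AddMonoidAlgebra k S) (toricVariety k S).functionField c ≠ 0 := by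
          rw [map_ne_zero_iff _ (IsFractionRing.injective _ _)]
          rintro rfl
          exact hc (zero_mem _)
        refine mul_right_cancel₀ hc0 (h.trans ?_)
        rw [IsScalarTower.algebraMap_apply _ ((toricVariety k S).presheaf.stalk v) _ c,
          ← map_mul,
          IsLocalization.mk'_spec _ a ⟨c, hc⟩, ← IsScalarTower.algebraMap_apply]
    let P : toricVariety k S := (⟨p, hp⟩ : PrimeSpectrum (AddMonoidAlgebra k S))
    have hPv : P ⤳ v := (PrimeSpectrum.le_iff_specializes (R := AddMonoidAlgebra k S) _ _).mp hpv
    have hP : IsLocalization.AtPrime ((toricVariety k S).presheaf.stalk P) p :=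
      inferInstanceAs (IsLocalization.AtPrime _ (toricPrime P))
    have : IsPrincipalIdealRing ((toricVariety k S).presheaf.stalk P) :=
      IsPrincipalIdealRing.of_surjective
        (IsLocalization.algEquiv p.primeCompl (Localization.AtPrime p)
          ((toricVariety k S).presheaf.stalk P)).toRingHom (AlgEquiv.surjective _)
    obtain ⟨y, hy⟩ := exists_logFunctional_eq_of_mem_logFormsAt hS hℓ P i
      (hω P (hPv.mem_open W.isOpen hvW) (mem_niceLocus_of_isPrincipalIdealRing hS P))
    obtain ⟨⟨a, c⟩, h⟩ := IsLocalization.surj (toricPrime P).primeCompl y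
    refine hfp a c c.2 ?_
    rw [hy, IsScalarTower.algebraMap_apply (AddMonoidAlgebra k S)
      ((toricVariety k S).presheaf.stalk P) _ (c : AddMonoidAlgebra k S), ← map_mul, h,
      ← IsScalarTower.algebraMap_apply]
  choose y hy using hreg
  obtain ⟨χ, hχ⟩ := hS.exists_character
    (IsFractionRing.injective (AddMonoidAlgebra k S) (toricVariety k S).functionField)
  rw [eq_sum_logFunctional hℓ χ hχ ω]
  refine Submodule.sum_mem _ fun i _ => ?_
  rw [hy, algebraMap_smul]
  refine Submodule.smul_mem _ _ ?_
  obtain ⟨p, q, -, h⟩ := hS.dlog_character_eq_sub (k := k) χ (b i)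
  rw [h, hχ, hχ]
  exact Submodule.sub_mem _ (Submodule.subset_span ⟨p, rfl⟩) (Submodule.subset_span ⟨q, rfl⟩)

end ToricForms

/-! ### Logarithmic forms and pullback -/

section Forms

variable {k : Type u} [Field k] {X Y : Scheme.{u}} [IsIntegral X] [IsIntegral Y]
  [X.Over (Spec (.of k))] [Y.Over (Spec (.of k))]

/-- A global function that is invertible on `U` has a logarithmic differential. -/
lemma dlog_mem_logStalk (U : Set X) (s : Γ(X, ⊤)) (hs : ∀ y ∈ U, y ∈ X.basicOpen s) (x : X) :
    dlog k (algebraMap _ X.functionField (X.presheaf.germ ⊤ x (Opens.mem_top _) s)) ∈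
      logStalk k U x := by
  refine ⟨⊤, trivial, fun p _ _ => Submodule.subset_span (Or.inr
    ⟨X.presheaf.germ ⊤ p (Opens.mem_top _) s, ⟨⊤, trivial, s, rfl, fun y _ => hs y⟩, ?_⟩)⟩
  have : Nonempty (⊤ : X.Opens) := ⟨⟨x, trivial⟩⟩
  rw [Scheme.algebraMap_germ_eq_germToFunctionField,
    Scheme.algebraMap_germ_eq_germToFunctionField]
  rfl

lemma pullbackForm_smul (f : X ⟶ Y) [f.IsOver (Spec (.of k))] [IsDominant f]
    (a : Y.functionField) (ω : RatForms k Y) :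
    pullbackForm f (a • ω) = pullbackRat f a • pullbackForm f ω := by
  let := (pullbackRat f).toAlgebra
  have : IsScalarTower k Y.functionField X.functionField :=
    .of_algebraMap_eq fun a => (pullbackRat_algebraMap f a).symm
  exact map_smul (KaehlerDifferential.map k k Y.functionField X.functionField) a ω

lemma pullbackForm_dlog (f : X ⟶ Y) [f.IsOver (Spec (.of k))] [IsDominant f]
    (a : Y.functionField) : pullbackForm f (dlog k a) = dlog k (pullbackRat f a) := by
  rw [dlog, dlog, pullbackForm_smul, map_inv₀]
  congr 1
  let := (pullbackRat f).toAlgebra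
  have : IsScalarTower k Y.functionField X.functionField :=
    .of_algebraMap_eq fun a => (pullbackRat_algebraMap f a).symm
  exact KaehlerDifferential.map_D k k Y.functionField X.functionField a

end Forms

section ToricPullback

lemma mem_basicOpen_of_mem_bigTorus {k : Type u} [Field k] {M : Type u} [AddCommGroup M]
    {S : AddSubmonoid M} (hS : IsToricMonoid S) {y : toricVariety k S}
    (hy : y ∈ bigTorus k S) (s : S) :
    y ∈ (toricVariety k S).basicOpen
      ((Scheme.ΓSpecIso (.of (AddMonoidAlgebra k S))).inv (.single s 1)) := by
  rw [Scheme.mem_basicOpen_top]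
  have h := (IsLocalization.AtPrime.isUnit_to_map_iff
    ((toricVariety k S).presheaf.stalk y) (toricPrime y) (.single s 1)).mpr
      ((mem_bigTorus_iff hS y).mp hy s)
  rwa [algebraMap_toricStalk] at h

variable {k : Type u} [Field k] {M : Type u} [AddCommGroup M]
  {S : AddSubmonoid M} {X : Scheme.{u}} [IsIntegral X] [X.Over (Spec (.of k))]
  (f : X ⟶ toricVariety k S) [f.IsOver (Spec (.of k))]

lemma dlog_stalkHom_mem_logStalk (hS : IsToricMonoid S) (x : X) (s : S) :
    dlog k (algebraMap _ X.functionField (stalkHom f x (.single s 1))) ∈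
      logStalk k (f ⁻¹' bigTorus k S) x := by
  refine dlog_mem_logStalk _ _ (fun y hy => ?_) x
  exact (Scheme.preimage_basicOpen_top f
    ((Scheme.ΓSpecIso (.of (AddMonoidAlgebra k S))).inv (.single s 1))).le
      (mem_basicOpen_of_mem_bigTorus hS hy s)

variable [Module.Free ℤ M] [IsDominant f]

lemma pullbackRat_algebraMap_monoidAlgebra (x : X) (a : AddMonoidAlgebra k S) :
    pullbackRat f (algebraMap (AddMonoidAlgebra k S) _ a) =
      algebraMap _ X.functionField (stalkHom f x a) := by
  rw [algebraMap_stalkHom, algebraMap_toricStalk]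

lemma dlog_stalkHom_mem_pulledBackLogStalk (hS : IsToricMonoid S) (x : X) (s : S) :
    dlog k (algebraMap _ X.functionField (stalkHom f x (.single s 1))) ∈
      pulledBackLogStalk k f (bigTorus k S) x := by
  refine Submodule.subset_span ⟨dlog k (algebraMap (AddMonoidAlgebra k S) _ (.single s 1)), ?_, ?_⟩
  · have h := dlog_mem_logStalk (k := k) (bigTorus k S)
      ((Scheme.ΓSpecIso (.of (AddMonoidAlgebra k S))).inv (.single s 1))
      (fun y hy => mem_basicOpen_of_mem_bigTorus hS hy s) (f x)
    rwa [← algebraMap_toricStalk, ← IsScalarTower.algebraMap_apply] at h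
  · rw [pullbackForm_dlog, pullbackRat_algebraMap_monoidAlgebra f x]

lemma pulledBackLogStalk_le [Module.Finite ℤ M] (hS : IsToricMonoid S) (x : X) :
    pulledBackLogStalk k f (bigTorus k S) x ≤ Submodule.span _ (Set.range fun s : S =>
      dlog k (algebraMap _ X.functionField (stalkHom f x (.single s 1)))) := by
  refine Submodule.span_le.mpr ?_
  rintro _ ⟨ω, hω, rfl⟩
  have h := logStalk_bigTorus_le hS (f x) hω
  clear hω
  rw [SetLike.mem_coe]
  induction h using Submodule.span_induction with
  | zero => rw [map_zero]; exact Submodule.zero_mem _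
  | add ω ω' _ _ h h' => rw [map_add]; exact Submodule.add_mem _ h h'
  | smul a ω _ h =>
    rw [← algebraMap_smul (toricVariety k S).functionField a ω, pullbackForm_smul,
      pullbackRat_algebraMap_stalk, algebraMap_smul]
    exact Submodule.smul_mem _ _ h
  | mem ω h =>
    obtain ⟨s, rfl⟩ := h
    beta_reduce
    rw [pullbackForm_dlog, pullbackRat_algebraMap_monoidAlgebra f x]
    exact Submodule.subset_span ⟨s, rfl⟩

end ToricPullback

end LogGeom

theorem lemma3 (k : Type u) [Field k] [CharZero k]
    {M : Type u} [AddCommGroup M] [Module.Free ℤ M] [Module.Finite ℤ M]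
    (S : AddSubmonoid M) (hS : IsToricMonoid S)
    (X : Scheme.{u}) [IsIntegral X] [X.Over (Spec (.of k))]
    [IsSeparated (X ↘ Spec (.of k))] [LocallyOfFiniteType (X ↘ Spec (.of k))]
    [QuasiCompact (X ↘ Spec (.of k))]
    (x : X) (hx : IsClosed {x})
    (ρ ψ : X ⟶ toricVariety k S) [ρ.IsOver (Spec (.of k))] [ψ.IsOver (Spec (.of k))]
    [Etale ρ] [IsDominant ψ]
    (hψT : ∀ y : X, ρ y ∈ bigTorus k S → ψ y ∈ bigTorus k S)
    (hunit : ∀ c : (toricVariety k S).functionField, IsCharacter c →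
      ∃ u : (X.presheaf.stalk x)ˣ,
        pullbackRat ρ c / pullbackRat ψ c = algebraMap _ X.functionField (u : X.presheaf.stalk x))
    (hlog : LogSmoothAt k ψ (ρ ⁻¹' bigTorus k S) (bigTorus k S) x) :
    ∃ W : X.Opens, x ∈ W ∧ Etale (W.ι ≫ ψ) := by
  have hu : ∀ s : S, ∃ u : (X.presheaf.stalk x)ˣ,
      stalkHom ρ x (.single s 1) = u * stalkHom ψ x (.single s 1) := fun s => by
    obtain ⟨u, hu⟩ := hunit (monomialRat s) ⟨s, 0, by
      rw [monomialRat_eq 0, ← AddMonoidAlgebra.one_def, map_one, div_one]⟩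
    refine ⟨u, IsFractionRing.injective _ X.functionField ?_⟩
    have h0 : algebraMap _ X.functionField (stalkHom ψ x (.single s 1)) ≠ 0 := by
      rw [map_ne_zero_iff _ (IsFractionRing.injective _ _),
        map_ne_zero_iff _ (stalkHom_injective ψ x)]
      exact AddMonoidAlgebra.single_ne_zero.mpr one_ne_zero
    rw [monomialRat_eq, pullbackRat_algebraMap_monoidAlgebra ρ x,
      pullbackRat_algebraMap_monoidAlgebra ψ x, div_eq_iff h0] at hu
    rw [hu, map_mul]
  choose u hu using hu
  have := locallyOfFinitePresentation_toricVariety hS.fg ψ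
  obtain ⟨hρ, hess⟩ := stalkHom_formallyEtale_of_etale ρ x
  exact exists_etale_of_stalkHom_formallyEtale ψ x
    (formallyEtale_of_free_quotient hS (stalkHom ρ x) (stalkHom ψ x) hρ hess
      (stalkHom_injective ρ x) (stalkHom_injective ψ x) u hu _ _
      (dlog_stalkHom_mem_logStalk ρ hS x) (dlog_stalkHom_mem_pulledBackLogStalk ψ hS x)
      (pulledBackLogStalk_le ψ hS x) hlog)
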